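/- **Arrowed binary sequences.** An arrowed binary sequence (ABS) $(\tilde S,\delta,\pi)$ is a finite totally ordered set $\tilde S=\{t_1<\dots<t_h\}$ with a map $\delta:\tilde S\to\{0,1\}$ and a bijection $\pi:\tilde S\to\tilde S$. Its length is $\ell=\#\{(t',t)\mid t'<t,\ \delta(t')=0,\ \delta(t)=1\}$. The binary expansion of $t\in\tilde S$ is $b(t)=0.b_1b_2\cdots$ with $b_r=\delta(\pi^{-r}(t))$. Let $p$ be a prime and $K$ a perfect field of characteristic $p$. A ${\rm DM}_1$ over $K$ is a finite-dimensional $K$-vector space $N$ with a $\sigma$-linear $F$ and a $\sigma^{-1}$-linear $V$ such that $\ker F=\operatorname{im}V$ and $\ker V=\operatorname{im}F$. The ABS $(\tilde S,\delta,\pi)$ is associated to $N$ if the following two conditions hold. (a) With $d=\#\{l\mid\delta(t_l)=0\}$, one has $\pi(t_r)=t_q$ where $q=\#\{l\le r\mid \delta(t_l)=0\}$ if $\delta(t_r)=0$ and $q=d+\#\{l\le r\mid\delta(t_l)=1\}$ if $\delta(t_r)=1$. (b) $N$ has a basis $(e_t)_{t\in\tilde S}$ with $Fe_t=e_{\pi(t)}$,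 $Ve_{\pi(t)}=0$ if $\delta(t)=0$, and $Fe_t=0$, $Ve_{\pi(t)}=e_t$ if $\delta(t)=1$. **The sequence $S$.** Let $N_{m,n}$ be the ${\rm DM}_1$ with basis $e_1,\dots,e_{m+n}$, $Fe_r=e_{r-m}$, $Ve_r=e_{r-n}$, where $e_r:=0$ for $r\le 0$. Let $(m_1,n_1)$, $(m_2,n_2)$ be pairs of coprime non-negative integers with $\lambda_2<1/2<\lambda_1$, where $h_r=m_r+n_r$, $\lambda_r=n_r/h_r$. Put $\xi=(m_1,n_1)+(m_2,n_2)$ and $N_\xi=N_{m_1,n_1}\oplus N_{m_2,n_2}$. Let $A$ be the ABS of $N_{m_1,n_1}$: the set $\{t_1<\dots<t_{h_1}\}$ with $\delta(t_r)=1$ iff $r\le m_1$ and $\pi(t_r)=t_{r-m_1 \bmod h_1}$. Let $B$ be the ABS of $N_{m_2,n_2}$, defined likewise. Let $S=A\oplus B=(\tilde S,\delta,\pi_0)$ be the disjoint union of $A$ and $B$, with $\delta$ and $\pi_0$ taken componentwise, ordered by binary expansion. Write $\tau^A_r$ (resp. $\tau^B_r$) for the $r$-th element of $A$ (resp. $B$),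 where $\tau$ is its label. **The exchange.** Let $0^A_i\in A$ and $1^B_j\in B$ be elements with labels $0$ and $1$ respectively such that $0^A_i<1^B_j$ in $S$. Let $\pi$ be the small modification of $\pi_0$: $\pi(\pi_0^{-1}(0^A_i))=1^B_j$, $\pi(\pi_0^{-1}(1^B_j))=0^A_i$, and $\pi=\pi_0$ elsewhere. Let $S'=(\tilde S',\delta,\pi)$ be the ABS obtained by exchanging $0^A_i$ and $1^B_j$. That is, $\tilde S'=\tilde S$ as sets, with an order $<'$ satisfying, for the binary expansions $b$ with respect to $\pi$: (i) $t<'t'$ implies $b(t)\le b(t')$; (ii) if $\delta(t)=\delta(t')$, then $t<'t'$ iff $\pi(t)<'\pi(t')$. If no order satisfies both (i) and (ii), only (i) is required; the length of $S'$ does not depend on the choice. **The sets $\mathcal A^{(n)}$.** Put $\alpha_n=\pi^n(0^A_i)$. Let $S^{(0)}$ be $\tilde S$ with $0^A_i$ and $1^B_j$ interchanged in the order. Let $\mathcal A^{(n)}$ be the set of $t\in A$ with $t<\alpha_n$ and $\alpha_{n+1}<\pi(t)$ in $S^{(n)}$ and $\delta(t)=\delta(\alpha_n)$. As long as $\mathcal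 A^{(n)}\ne\emptyset$, the ordered set $S^{(n+1)}$ is obtained from $S^{(n)}$ by moving $\alpha_{n+1}$ immediately to the right of $\pi(\max\mathcal A^{(n)})$, the maximum being taken in $S^{(n)}$. The process stops at the least $a$ with $\mathcal A^{(a)}=\emptyset$. **The sets $\mathcal B^{(n)}$.** Put $\beta_n=\pi^n(1^B_j)$. Let $\mathcal B^{(n)}$ be the set of $t\in\tilde S$ with $\beta_n<t$ and $\pi(t)<\beta_{n+1}$ in $S^{(a+n)}$ and $\delta(t)=\delta(\beta_n)$. As long as $\mathcal B^{(n)}\neq\emptyset$, the ordered set $S^{(a+n+1)}$ is obtained from $S^{(a+n)}$ by moving $\beta_{n+1}$ immediately to the left of $\pi(\min\mathcal B^{(n)})$, the minimum being taken in $S^{(a+n)}$. The process stops as soon as some $\mathcal B^{(n)}$ is empty. **Theorem.** The ABS $S$ is associated to $N_\xi$. For all $0^A_i$ and $1^B_j$ as above, some $\mathcal A^{(n)}$ is empty (so $a$ exists), and $$\ell(S')=\ell(S)-1$$ holds if and only if there is no non-negative integer $n$ such that $\mathcal A^{(n)}$ contains $\pi^{-1}(1^B_j)$ or $\mathcal B^{(n)}$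 contains $\pi^{-1}(0^A_i)$ (only those $\mathcal A^{(n)}$, $\mathcal B^{(n)}$ that are reached by the process being considered). -/

import Mathlib

noncomputable section

universe u

/-! ### Truncated Dieudonné modules of level one -/

/-- A truncated Dieudonné module of level one over a perfect field `K` of characteristic `p`:
a finite dimensional `K`-vector space with a `σ`-linear map `F` and a `σ⁻¹`-linear map `V`
such that `Ker F = Im V` and `Ker V = Im F`. -/
structure DM1 (p : ℕ) (K : Type u) [Field K] [Fact p.Prime] [CharP K p] [PerfectRing K p] where
  carrier : Type u
  [grp : AddCommGroup carrier]
  [mod : Module K carrier]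
  [fin : Module.Finite K carrier]
  F : carrier →ₛₗ[(frobeniusEquiv K p : K →+* K)] carrier
  V : carrier →ₛₗ[((frobeniusEquiv K p).symm : K →+* K)] carrier
  ker_F : ∀ x, F x = 0 ↔ ∃ y, V y = x
  ker_V : ∀ x, V x = 0 ↔ ∃ y, F y = x

namespace DM1

attribute [instance] DM1.grp DM1.mod DM1.fin

variable (p : ℕ) (K : Type u) [Field K] [Fact p.Prime] [CharP K p] [PerfectRing K p]

/-- The module `N_{m,n}` of the `p`-kernel of `H_{m,n}`. The Dieudonné module of `H_{m,n}` has
basis `e_1, …, e_h` with `h = m + n`, `F e_i = e_{i-m}`, `V e_i = e_{i-n}` and `e_{i-h} = p e_i`;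
modulo `p` one gets `F e_i = e_{i-m}` for `i > m`, `F e_i = 0` for `i ≤ m`, `V e_i = e_{i-n}` for
`i > n` and `V e_i = 0` for `i ≤ n`. Below, `F` and `V` are written in coordinates. -/
def simple (m n : ℕ) : DM1 p K where
  carrier := Fin (m + n) → K
  F :=
    { toFun := fun x j => if hj : j.val < n then frobeniusEquiv K p (x ⟨j.val + m, by omega⟩) else 0
      map_add' := by
        intro x y; ext j; by_cases hj : j.val < n <;> simp [hj]
      map_smul' := by
        intro c x; ext j; by_cases hj : j.val < n <;> simp [hj] }
  V :=
    { toFun := fun x j =>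
        if hj : j.val < m then (frobeniusEquiv K p).symm (x ⟨j.val + n, by omega⟩) else 0
      map_add' := by
        intro x y; ext j; by_cases hj : j.val < m <;> simp [hj]
      map_smul' := by
        intro c x; ext j; by_cases hj : j.val < m <;> simp [hj] }
  ker_F := by
    intro x
    constructor
    · intro hx
      refine ⟨fun j => if hj : n ≤ j.val then
        frobeniusEquiv K p (x ⟨j.val - n, by omega⟩) else 0, ?_⟩
      ext j
      by_cases hj : j.val < m
      · simp [hj]
      · have h1 := congrFun hx ⟨j.val - m, by omega⟩
        have h2 : j.val - m < n := by omega
        have h3 : j.val - m + m = j.val := by omega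
        simp only [LinearMap.coe_mk, AddHom.coe_mk, h2, dite_true, h3, Pi.zero_apply] at h1
        rw [map_eq_zero_iff _ (frobeniusEquiv K p).injective] at h1
        simp [hj, h1]
    · rintro ⟨y, rfl⟩
      ext j
      by_cases hj : j.val < n <;> simp [hj]
  ker_V := by
    intro x
    constructor
    · intro hx
      refine ⟨fun j => if hj : m ≤ j.val then
        (frobeniusEquiv K p).symm (x ⟨j.val - m, by omega⟩) else 0, ?_⟩
      ext j
      by_cases hj : j.val < n
      · simp [hj]
      · have h1 := congrFun hx ⟨j.val - n, by omega⟩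
        have h2 : j.val - n < m := by omega
        have h3 : j.val - n + n = j.val := by omega
        simp only [LinearMap.coe_mk, AddHom.coe_mk, h2, dite_true, h3, Pi.zero_apply] at h1
        rw [map_eq_zero_iff _ (frobeniusEquiv K p).symm.injective] at h1
        simp [hj, h1]
    · rintro ⟨y, rfl⟩
      ext j
      by_cases hj : j.val < m <;> simp [hj]

variable {p K}

/-- The direct sum of two modules. -/
def prod (M N : DM1 p K) : DM1 p K where
  carrier := M.carrier × N.carrier
  F :=
    { toFun := fun x => (M.F x.1, N.F x.2)
      map_add' := by intro x y; simp
      map_smul' := by intro c x; simp }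
  V :=
    { toFun := fun x => (M.V x.1, N.V x.2)
      map_add' := by intro x y; simp
      map_smul' := by intro c x; simp }
  ker_F := by
    rintro ⟨x, y⟩
    change (M.F x, N.F y) = 0 ↔ ∃ z : M.carrier × N.carrier, (M.V z.1, N.V z.2) = (x, y)
    simp [Prod.ext_iff, M.ker_F, N.ker_F]
  ker_V := by
    rintro ⟨x, y⟩
    change (M.V x, N.V y) = 0 ↔ ∃ z : M.carrier × N.carrier, (M.F z.1, N.F z.2) = (x, y)
    simp [Prod.ext_iff, M.ker_V, N.ker_V]

end DM1

/-! ### Arrowed binary sequences -/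

/-- An arrowed binary sequence with underlying (finite) set `X`: a total order on `X`, a labelling
`δ : X → {0, 1}` and a bijection `π : X → X`. The order is a field, since several orders on the
same set are compared. -/
structure ABS (X : Type*) where
  ord : LinearOrder X
  δ : X → Fin 2
  π : Equiv.Perm X

namespace ABS

variable {X Y : Type*}

/-- The length: the number of pairs `(t', t)` with `t' < t`, `δ t' = 0` and `δ t = 1`. -/
def length (S : ABS X) : ℕ :=
  {q : X × X | S.δ q.1 = 0 ∧ S.δ q.2 = 1 ∧ S.ord.lt q.1 q.2}.ncard

/-- The binary expansion `b(t) = 0.b₁b₂…` with `b_i = δ(π^{-i}(t))`, as the sequence of its digits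
(`binExp δ π t i` is `b_{i+1}`). Expansions are compared lexicographically; since `X` is finite
they are periodic, so this is the comparison of the real numbers they represent. -/
def binExp (δ : X → Fin 2) (π : Equiv.Perm X) (t : X) : Lex (ℕ → Fin 2) :=
  toLex fun i => δ ((π ^ (i + 1)).symm t)

/-- The position `i` of `t = t_i` in `{t_1 < ⋯ < t_h}`. -/
def rank (S : ABS X) (t : X) : ℕ := {u | S.ord.le u t}.ncard

/-- `π` is the bijection determined by the binary sequence `(X, <, δ)`: with `d` the number of `t`
with `δ t = 0`, it sends `t_i` to `t_j`, where `j = #{l ≤ i | δ(t_l) = 0}` if `δ(t_i) = 0`, and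
`j = d + #{l ≤ i | δ(t_l) = 1}` if `δ(t_i) = 1`. -/
def IsAdmissible (S : ABS X) : Prop :=
  ∀ t, (S.δ t = 0 → S.rank (S.π t) = {u | S.ord.le u t ∧ S.δ u = 0}.ncard) ∧
    (S.δ t = 1 → S.rank (S.π t) = {u | S.δ u = 0}.ncard + {u | S.ord.le u t ∧ S.δ u = 1}.ncard)

/-- `S` is the arrowed binary sequence associated to `N`: it is admissible, and `N` has a standard
basis `(e_t)` for it, i.e. `F e_t = e_{π t}` and `V e_{π t} = 0` if `δ t = 0`, while `F e_t = 0` and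
`V e_{π t} = e_t` if `δ t = 1`. -/
def IsAssociated {p : ℕ} {K : Type u} [Field K] [Fact p.Prime] [CharP K p] [PerfectRing K p]
    (S : ABS X) (N : DM1 p K) : Prop :=
  S.IsAdmissible ∧ ∃ e : Module.Basis X K N.carrier, ∀ t,
    (S.δ t = 0 → N.F (e t) = e (S.π t) ∧ N.V (e (S.π t)) = 0) ∧
    (S.δ t = 1 → N.F (e t) = 0 ∧ N.V (e (S.π t)) = e t)

/-- The arrowed binary sequence of `N_{m,n}`: the set `{t_1 < ⋯ < t_h}`, `h = m + n`, with
`δ(t_i) = 1` if and only if `i ≤ m`, and `π(t_i) = t_{i - m mod h}`. (Indices start at `0` below.) -/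
def simple (m n : ℕ) : ABS (Fin (m + n)) where
  ord := inferInstance
  δ := fun i => if i.val < m then 1 else 0
  π := finAddFlip.trans (finCongr (Nat.add_comm n m))

/-- The order on `X` by binary expansion, where `tie` orders elements with equal expansion. -/
abbrev binOrder (tie : LinearOrder X) (δ : X → Fin 2) (π : Equiv.Perm X) : LinearOrder X :=
  LinearOrder.lift' (fun x : X => toLex (binExp δ π x, x))
    (fun _ _ h => congrArg (fun q => (ofLex q).2) h)

/-- The order on a disjoint union with all of `X` before all of `Y`. -/
abbrev sumOrder (o : LinearOrder X) (o' : LinearOrder Y) : LinearOrder (X ⊕ Y) :=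
  LinearOrder.lift' (fun x : X ⊕ Y => toLex x) toLex.injective

/-- The direct sum `A ⊕ B`: the disjoint union, with `δ` and `π` taken componentwise, ordered by
binary expansion; elements with equal expansion are ordered as in `A` and `B`, with those of `A`
before those of `B`. -/
def directSum (A : ABS X) (B : ABS Y) : ABS (X ⊕ Y) where
  ord := binOrder (sumOrder A.ord B.ord) (Sum.elim A.δ B.δ) (Equiv.sumCongr A.π B.π)
  δ := Sum.elim A.δ B.δ
  π := Equiv.sumCongr A.π B.π

/-! ### Exchanging two elements -/

/-- The small modification of `π₀` by `s` and `t`: it sends `π₀⁻¹(s)` to `t`, `π₀⁻¹(t)` to `s`, and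
agrees with `π₀` elsewhere. -/
def smallMod [DecidableEq X] (π₀ : Equiv.Perm X) (s t : X) : Equiv.Perm X :=
  π₀.trans (Equiv.swap s t)

/-- Condition (i) on an order: `x < y` implies `b(x) ≤ b(y)`. -/
def OrderedByExp (o : LinearOrder X) (δ : X → Fin 2) (π : Equiv.Perm X) : Prop :=
  ∀ x y, o.lt x y → binExp δ π x ≤ binExp δ π y

/-- Condition (ii) on an order: `π` is increasing on elements with equal label. -/
def IncreasingOnLabels (o : LinearOrder X) (δ : X → Fin 2) (π : Equiv.Perm X) : Prop :=
  ∀ x y, δ x = δ y → (o.lt x y ↔ o.lt (π x) (π y))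

/-- `S'` is obtained from `S` by exchanging `s` and `t`: it has the same labels, its bijection is the
small modification, and its order satisfies conditions (i) and (ii). There are exchanges for which
several elements have the same binary expansion and no order satisfies both (i) and (ii); then only
(i) is asked for, and `S'` is ordered by binary expansion (its length does not depend on the order
of elements with equal expansions, as these have equal labels). -/
structure IsExchange [DecidableEq X] (S : ABS X) (s t : X) (S' : ABS X) : Prop where
  δ_eq : S'.δ = S.δ
  π_eq : S'.π = smallMod S.π s t
  ordered : OrderedByExp S'.ord S'.δ S'.π
  increasing : (∃ o, OrderedByExp o S'.δ S'.π ∧ IncreasingOnLabels o S'.δ S'.π) →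
    IncreasingOnLabels S'.ord S'.δ S'.π

/-- Exchanging is always possible. -/
theorem exists_isExchange [DecidableEq X] (S : ABS X) (s t : X) : ∃ S', IsExchange S s t S' := by
  by_cases h : ∃ o, OrderedByExp o S.δ (smallMod S.π s t) ∧
      IncreasingOnLabels o S.δ (smallMod S.π s t)
  · obtain ⟨o, h1, h2⟩ := h
    exact ⟨⟨o, S.δ, smallMod S.π s t⟩, rfl, rfl, h1, fun _ => h2⟩
  · refine ⟨⟨binOrder S.ord S.δ (smallMod S.π s t), S.δ, smallMod S.π s t⟩, rfl, rfl, ?_,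
      fun h' => absurd h' h⟩
    intro x y hxy
    let _ := S.ord
    have hxy' : toLex (binExp S.δ (smallMod S.π s t) x, x) <
      toLex (binExp S.δ (smallMod S.π s t) y, y) := hxy
    rcases Prod.Lex.toLex_lt_toLex.1 hxy' with h1 | h1
    · exact h1.le
    · exact h1.1.le

/-! ### The sets `𝒜⁽ⁿ⁾`, `ℬ⁽ⁿ⁾` and the orders `S⁽ⁿ⁾` -/

/-- The order in which `s` and `t` have traded places. -/
abbrev swapOrder [DecidableEq X] (o : LinearOrder X) (s t : X) : LinearOrder X :=
  LinearOrder.lift' (Equiv.swap s t) (Equiv.swap s t).injective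

open Classical in
/-- The order obtained by moving `c` to the place immediately to the right of `u`. -/
abbrev moveRight (o : LinearOrder X) (c u : X) : LinearOrder X :=
  LinearOrder.lift' (fun x : X => if x = c then toLex (u, true) else toLex (x, false)) (by
    intro x y h
    by_cases hx : x = c <;> by_cases hy : y = c <;> simp_all)

open Classical in
/-- The order obtained by moving `c` to the place immediately to the left of `u`. -/
abbrev moveLeft (o : LinearOrder X) (c u : X) : LinearOrder X :=
  LinearOrder.lift' (fun x : X => if x = c then toLex (u, false) else toLex (x, true)) (by
    intro x y h
    by_cases hx : x = c <;> by_cases hy : y = c <;> simp_all)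

theorem exists_max [Finite X] (o : LinearOrder X) (T : Set X) (hT : T.Nonempty) :
    ∃ t ∈ T, ∀ u ∈ T, o.le u t := by
  let _ := o
  exact Set.exists_max_image T id T.toFinite hT

theorem exists_min [Finite X] (o : LinearOrder X) (T : Set X) (hT : T.Nonempty) :
    ∃ t ∈ T, ∀ u ∈ T, o.le t u := by
  let _ := o
  exact Set.exists_min_image T id T.toFinite hT

/-- The largest element of a nonempty set. -/
def maxElt [Finite X] (o : LinearOrder X) (T : Set X) (hT : T.Nonempty) : X :=
  (exists_max o T hT).choose

/-- The smallest element of a nonempty set. -/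
def minElt [Finite X] (o : LinearOrder X) (T : Set X) (hT : T.Nonempty) : X :=
  (exists_min o T hT).choose

/-- The elements `t` of the first summand with `t < αₙ`, `αₙ₊₁ < π t` and `δ t = δ αₙ`, where
`αₙ = πⁿ(s)`. -/
def aSetOf (o : LinearOrder (X ⊕ Y)) (δ : X ⊕ Y → Fin 2) (π : Equiv.Perm (X ⊕ Y)) (s : X ⊕ Y)
    (n : ℕ) : Set (X ⊕ Y) :=
  {t | t.isLeft ∧ o.lt t ((π ^ n) s) ∧ o.lt ((π ^ (n + 1)) s) (π t) ∧ δ t = δ ((π ^ n) s)}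

/-- The elements `t` with `βₙ < t`, `π t < βₙ₊₁` and `δ t = δ βₙ`, where `βₙ = πⁿ(s)`. -/
def bSetOf (o : LinearOrder X) (δ : X → Fin 2) (π : Equiv.Perm X) (s : X) (n : ℕ) : Set X :=
  {t | o.lt ((π ^ n) s) t ∧ o.lt (π t) ((π ^ (n + 1)) s) ∧ δ t = δ ((π ^ n) s)}

variable [Finite X] [Finite Y] [DecidableEq X] [DecidableEq Y]

open Classical in
/-- The pair `(S⁽ⁿ⁾, 𝒜⁽ⁿ⁾)` for the exchange of `s` and `t`, `n ≤ a`: one starts with `S` with `s`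
and `t` trading places, and `S⁽ⁿ⁺¹⁾` is obtained from `S⁽ⁿ⁾` by moving `αₙ₊₁` to the right of
`π(t_max)` with `t_max = max 𝒜⁽ⁿ⁾`. Once `𝒜⁽ⁿ⁾` is empty the process stops (all later sets are
empty and the order stays). -/
def aStep (S : ABS (X ⊕ Y)) (s t : X ⊕ Y) : ℕ → LinearOrder (X ⊕ Y) × Set (X ⊕ Y)
  | 0 => (swapOrder S.ord s t, aSetOf (swapOrder S.ord s t) S.δ (smallMod S.π s t) s 0)
  | n + 1 =>
    if h : (aStep S s t n).2.Nonempty then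
      let π := smallMod S.π s t
      let o := moveRight (aStep S s t n).1 ((π ^ (n + 1)) s)
        (π (maxElt (aStep S s t n).1 (aStep S s t n).2 h))
      (o, aSetOf o S.δ π s (n + 1))
    else ((aStep S s t n).1, ∅)

/-- The set `𝒜⁽ⁿ⁾`. -/
def aSet (S : ABS (X ⊕ Y)) (s t : X ⊕ Y) (n : ℕ) : Set (X ⊕ Y) := (aStep S s t n).2

/-- The smallest `a` with `𝒜⁽ᵃ⁾ = ∅`. -/
def aStop (S : ABS (X ⊕ Y)) (s t : X ⊕ Y) : ℕ := sInf {n | aSet S s t n = ∅}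

open Classical in
/-- The pair `(S⁽ᵃ⁺ⁿ⁾, ℬ⁽ⁿ⁾)` for the exchange of `s` and `t`: one starts with `S⁽ᵃ⁾`, and
`S⁽ᵃ⁺ⁿ⁺¹⁾` is obtained from `S⁽ᵃ⁺ⁿ⁾` by moving `βₙ₊₁` to the left of `π(t_min)` with
`t_min = min ℬ⁽ⁿ⁾`. Once `ℬ⁽ⁿ⁾` is empty the process stops. -/
def bStep (S : ABS (X ⊕ Y)) (s t : X ⊕ Y) : ℕ → LinearOrder (X ⊕ Y) × Set (X ⊕ Y)
  | 0 => ((aStep S s t (aStop S s t)).1,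
      bSetOf (aStep S s t (aStop S s t)).1 S.δ (smallMod S.π s t) t 0)
  | n + 1 =>
    if h : (bStep S s t n).2.Nonempty then
      let π := smallMod S.π s t
      let o := moveLeft (bStep S s t n).1 ((π ^ (n + 1)) t)
        (π (minElt (bStep S s t n).1 (bStep S s t n).2 h))
      (o, bSetOf o S.δ π t (n + 1))
    else ((bStep S s t n).1, ∅)

/-- The set `ℬ⁽ⁿ⁾`. -/
def bSet (S : ABS (X ⊕ Y)) (s t : X ⊕ Y) (n : ℕ) : Set (X ⊕ Y) := (bStep S s t n).2

end ABS

end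

/-! Write `s`, `t` for the exchanged elements and `π` for the new bijection. In `S`, images under
the old bijection compare by label first and then as their preimages.

Counting. Let the `k`-th relation compare `k` digits of the expansions for `π` and then the `k`-th
preimages in `S`. For large `k` it orders elements of different label by expansion, so it computes
the length of `S'`. A pair reversed from one relation to the next is carried by `π` to the next
stage if its labels agree; otherwise it disappears and changes the length by one. Length plus number
of reversals therefore never increases, and it falls by two for each pair lost. After one step it
equals `ℓ(S) - 1`. Hence `ℓ(S') = ℓ(S) - 1` holds exactly when every initial reversal with equal
labels ends as a gain, which is a lexicographic comparison of forward label sequences: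
`length_exchange_iff`. The pairs concerned are `(u, s)` with `u` of label 0, and `(t, w)` with `w`
of label 1, for `u`, `w` between `s` and `t`.

Processes. The sets `𝒜⁽ⁿ⁾` consist of the `πⁿ(u)` whose orbits have shown the labels of the orbit of
`s` so far without leaving the first summand; if the first process does not meet `π⁻¹(t)`, the
`ℬ⁽ⁿ⁾` likewise follow the orbits of the `w` against that of `t` (`aSet_eq_leftSet`,
`bSet_eq_rightSet`).

Rotations and words. On each summand the old bijection is a rotation that preserves the distance of
two points while their labels agree, so the first difference has label 0 at the larger point. The
comparison thus comes out right unless an orbit first passes `π⁻¹(t)` (resp. `π⁻¹(s)`), which is a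
hit. Conversely a hit makes it fail. Let `W`, `W'` be the label words of `i` and `j`; by the slopes,
`W` has no two consecutive ones and `W'` no two consecutive zeros. A hit in `𝒜` gives a border of
`W`, and the comparison becomes one between two shifts of the periodic sequence `WW'WW'⋯`. Both
shifts are forced to alternate, and periodicity or a count of ones excludes the required first
difference (`not_seqLt_of_border`). Complementing labels handles `ℬ`. -/

/-! ### Binary sequences -/

/-- The strict lexicographic order on binary sequences. -/
def SeqLt (f g : ℕ → Bool) : Prop :=
  ∃ n, (∀ k < n, f k = g k) ∧ f n = false ∧ g n = true

/-- A word of length `2g + 1` without two consecutive ones has at most `g + 1` ones, and equality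
forces it to be `1010⋯01`. -/
theorem alternating_of_count (w : ℕ → Bool) (g : ℕ)
    (h : ∀ k, k + 1 < 2 * g + 1 → w k = true → w (k + 1) = false) :
    (∑ k ∈ Finset.range (2 * g + 1), (w k).toNat) ≤ g + 1 ∧
    ((∑ k ∈ Finset.range (2 * g + 1), (w k).toNat) = g + 1 →
      ∀ k < 2 * g + 1, w k = decide (k % 2 = 0)) := by
  induction g with
  | zero =>
    simp only [mul_zero, zero_add, Finset.sum_range_one]
    refine ⟨Bool.toNat_le _, fun h1 k hk => ?_⟩
    obtain rfl : k = 0 := by omega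
    cases h0 : w 0 <;> simp_all
  | succ g ih =>
    have ih := ih (fun k hk => h k (by omega))
    rw [show 2 * (g + 1) + 1 = 2 * g + 2 + 1 by ring, Finset.sum_range_succ,
      show 2 * g + 2 = 2 * g + 1 + 1 by ring, Finset.sum_range_succ,
      show 2 * g + 1 + 1 = 2 * g + 2 by ring]
    have h1 : w (2 * g + 1) = true → w (2 * g + 2) = false := h (2 * g + 1) (by omega)
    have h2 := h (2 * g) (by omega)
    have hle : (w (2 * g + 1)).toNat + (w (2 * g + 2)).toNat ≤ 1 := by
      cases h3 : w (2 * g + 1) <;> cases h4 : w (2 * g + 2) <;> simp_all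
    refine ⟨by omega, fun h3 k hk => ?_⟩
    have h4 := ih.2 (by omega)
    have h5 : w (2 * g) = true := by rw [h4 _ (by omega)]; simp
    have h6 := h2 h5
    by_cases hk1 : k < 2 * g + 1
    · exact h4 k hk1
    · rcases (by omega : k = 2 * g + 1 ∨ k = 2 * g + 2) with rfl | rfl
      · rw [h6]; simp
      · have h7 : (w (2 * g + 2)).toNat = 1 := by
          rw [h6] at h3
          have := ih.1
          have := Bool.toNat_le (w (2 * g + 2))
          simp only [Bool.toNat_false] at h3
          omega
        cases h8 : w (2 * g + 2)
        · simp [h8] at h7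
        · simp

theorem eq_of_periodic_of_eq_lt {f g : ℕ → Bool} {N : ℕ} (hN : 0 < N)
    (hf : ∀ k, f (k + N) = f k) (hg : ∀ k, g (k + N) = g k) (h : ∀ k < N, f k = g k) (k : ℕ) :
    f k = g k := by
  induction k using Nat.strong_induction_on with
  | _ k ih =>
    by_cases hk : k < N
    · exact h k hk
    · obtain ⟨l, rfl⟩ := Nat.exists_eq_add_of_le' (by omega : N ≤ k)
      rw [hf, hg]
      exact ih l (by omega)

/-- Let `z` be periodic with period a word `W W'`, where `W` has length `h₁` and no two consecutive
ones, and `W'` has length `h₂` and no two consecutive zeros. If `W` has a border of length `p`, then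
(under the balancedness assumption `hmono` on `W`) the shift of `z` by `h₁` is not smaller
than the shift by `p`. -/
theorem not_seqLt_of_border (z : ℕ → Bool) (h₁ h₂ p : ℕ) (hp : 0 < p) (hp1 : p < h₁)
    (hper : ∀ k, z (k + (h₁ + h₂)) = z k)
    (z0 : z 0 = false) (y0 : z h₁ = true)
    (no11 : ∀ k, k + 1 < h₁ → z k = true → z (k + 1) = false)
    (no00 : ∀ k, k + 1 < h₂ → z (h₁ + k) = false → z (h₁ + (k + 1)) = true)
    (hend : (∃ e, h₂ = e + 1 ∧ z (h₁ + e) = true) ∨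
      ∃ k, k + 1 < h₂ ∧ z (h₁ + k) = true ∧ z (h₁ + (k + 1)) = true)
    (hmono : z (h₁ - 1) = false → ∀ r, 0 < r → r < h₁ → z (r - 1) = true →
      ∀ n, r + n < h₁ → (∀ k < n, z (r + k) = z k) → z (r + n) = true → z n = true)
    (border : ∀ k < p, z k = z (k + (h₁ - p))) :
    ¬ SeqLt (fun k => z (h₁ + k)) (fun k => z (p + k)) := by
  rintro ⟨n, hagree, hn0, hn1⟩
  dsimp only at hagree hn0 hn1
  have h2pos : 0 < h₂ := by rcases hend with ⟨e, he, _⟩ | ⟨k, hk, _⟩ <;> omega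
  have zp : z p = true := by
    rcases Nat.eq_zero_or_pos n with rfl | hn
    · simpa using hn1
    · have := hagree 0 hn
      simp only [add_zero] at this
      rw [← this, y0]
  have zp1 : z (p - 1) = false := by
    cases h : z (p - 1)
    · rfl
    · have := no11 (p - 1) (by omega) h
      rw [Nat.sub_add_cancel hp, zp] at this
      cases this
  -- The two copies of the border end at `p - 1` and `h₁ - 1`, and a one follows the first.
  have zl : z (h₁ - 1) = false := by
    rw [← zp1, border (p - 1) (by omega)]
    congr 1; omega
  have hM := hmono zl
  -- The difference at `n` needs 0 after `h₁` and 1 after `p`. After a common 1 the letter of `W` is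
  -- 0, and after a common 0 the letter of `W'` is 1, so neither place can be `n`: both sides
  -- alternate while they stay inside their words.
  have alt : ∀ k, k < h₂ → p + k < h₁ → k < n ∧ z (h₁ + k) = decide (k % 2 = 0) ∧
      z (p + k) = decide (k % 2 = 0) := by
    intro k
    induction k with
    | zero =>
      intro _ _
      refine ⟨Nat.pos_of_ne_zero ?_, by simpa using y0, by simpa using zp⟩
      rintro rfl
      simp [y0] at hn0
    | succ k ih =>
      intro hk1 hk2
      obtain ⟨hkn, hy, hz⟩ := ih (by omega) (by omega)
      rcases Nat.mod_two_eq_zero_or_one k with hk | hk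
      · have e1 : z (p + (k + 1)) = false := no11 (p + k) (by omega) (by simp [hz, hk])
        have hne : k + 1 ≠ n := by
          rintro rfl
          rw [e1] at hn1; cases hn1
        have e2 := hagree (k + 1) (by omega)
        rw [e2, e1]
        refine ⟨by omega, ?_, ?_⟩ <;> simp <;> omega
      · have e1 : z (h₁ + (k + 1)) = true := no00 k (by omega) (by simp [hy, hk])
        have hne : k + 1 ≠ n := by
          rintro rfl
          rw [e1] at hn0; cases hn0
        have e2 := hagree (k + 1) (by omega)
        rw [← e2, e1]
        refine ⟨by omega, ?_, ?_⟩ <;> simp <;> omega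
  by_cases hcase : h₁ - p ≤ h₂
  · -- the word following the border alternates
    have q1 := alt (h₁ - 1 - p) (by omega) (by omega)
    have ev : (h₁ - 1 - p) % 2 = 1 := by
      have h := q1.2.2
      rw [show p + (h₁ - 1 - p) = h₁ - 1 by omega, zl] at h
      have := of_decide_eq_false h.symm
      omega
    obtain ⟨q, hq⟩ : ∃ q, h₁ - p = 2 * q := ⟨(h₁ - p) / 2, by omega⟩
    -- The border gives `W` the even period `h₁ - p = 2q`, so the alternation of its last `2q`
    -- letters spreads back to its beginning.
    have Walt : ∀ m, m < h₁ → z (h₁ - 1 - m) = decide (m % 2 = 1) := by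
      intro m
      induction m using Nat.strong_induction_on with
      | _ m ih =>
        intro hm
        by_cases hm2 : m < 2 * q
        · have := (alt (h₁ - 1 - m - p) (by omega) (by omega)).2.2
          rw [show p + (h₁ - 1 - m - p) = h₁ - 1 - m by omega] at this
          rw [this]
          congr 1
          apply propext
          omega
        · rw [border _ (by omega), show h₁ - 1 - m + (h₁ - p) = h₁ - 1 - (m - 2 * q) by omega,
            ih (m - 2 * q) (by omega) (by omega)]
          congr 1
          apply propext
          omega
    have hodd : (h₁ - 1) % 2 = 0 := by
      have h := Walt (h₁ - 1) (by omega)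
      rw [Nat.sub_self, z0] at h
      have := of_decide_eq_false h.symm
      omega
    have Walt' : ∀ m, m < h₁ → z m = decide (m % 2 = 1) := by
      intro m hm
      have := Walt (h₁ - 1 - m) (by omega)
      rw [show h₁ - 1 - (h₁ - 1 - m) = m by omega] at this
      rw [this]
      congr 1
      apply propext
      omega
    have hshift : ∀ k, z (p + (k + 2 * q)) = z (h₁ + k) := by
      intro k; congr 1; omega
    have hq0 : 0 < q := by omega
    -- Since `p + 2q = h₁`, agreement of the two shifts below `n` is periodicity by `2q`, which
    -- propagates the alternation.
    have yalt : ∀ m, m < n → z (h₁ + m) = decide (m % 2 = 0) := by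
      intro m
      induction m using Nat.strong_induction_on with
      | _ m ih =>
        intro hm
        by_cases hm2 : m < 2 * q
        · exact (alt m (by omega) (by omega)).2.1
        · have := ih (m - 2 * q) (by omega) (by omega)
          rw [hagree m hm, show p + m = p + (m - 2 * q + 2 * q) by omega, hshift, this]
          congr 1
          apply propext
          omega
    have hnq : 2 * q ≤ n := by
      by_contra hlt
      exact absurd (alt n (by omega) (by omega)).1 (lt_irrefl _)
    -- If `n = 2q`, the letter before place `n` is 0, so a 0 there is impossible inside `W'`; and if
    -- `W'` ends there it is `1010⋯10`, against `hend`.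
    rcases Nat.eq_or_lt_of_le hnq with hnq | hnq
    · subst hnq
      by_cases hq2 : 2 * q < h₂
      · have e1 := yalt (2 * q - 1) (by omega)
        have e2 := no00 (2 * q - 1) (by omega) (by rw [e1]; simp; omega)
        rw [show 2 * q - 1 + 1 = 2 * q by omega, hn0] at e2
        cases e2
      · have hh : h₂ = 2 * q := by omega
        rcases hend with ⟨e, he, he1⟩ | ⟨k, hk, hk1, hk2⟩
        · rw [yalt e (by omega)] at he1
          have := of_decide_eq_true he1
          omega
        · rw [yalt k (by omega)] at hk1
          rw [yalt (k + 1) (by omega)] at hk2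
          have := of_decide_eq_true hk1
          have := of_decide_eq_true hk2
          omega
    · have hneven : n % 2 = 0 := by
        have h := yalt (n - 2 * q) (by omega)
        rw [← hshift, show n - 2 * q + 2 * q = n by omega, hn1] at h
        have := of_decide_eq_true h.symm
        omega
      have hy1 : z (h₁ + (n - 1)) = false := by
        rw [yalt _ (by omega)]; simp; omega
      by_cases hnh : n < h₂
      · have := no00 (n - 1) (by omega) hy1
        rw [show n - 1 + 1 = n by omega, hn0] at this
        cases this
      · have h2odd : h₂ % 2 = 1 := by
          rcases hend with ⟨e, he, he1⟩ | ⟨k, hk, hk1, hk2⟩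
          · rw [yalt e (by omega)] at he1
            have := of_decide_eq_true he1
            omega
          · rw [yalt k (by omega)] at hk1
            rw [yalt (k + 1) (by omega)] at hk2
            have := of_decide_eq_true hk1
            have := of_decide_eq_true hk2
            omega
        -- Both words alternate and have odd length, `W'` from 1 to 1 and `W` from 0 to 0, so `z`
        -- alternates without end and shows 1 at the even place `n`.
        have all := eq_of_periodic_of_eq_lt (f := fun k => z (h₁ + k))
          (g := fun k => decide (k % 2 = 0)) (N := h₁ + h₂) (by omega)
          (fun k => by rw [← add_assoc, hper])
          (fun k => by congr 1; apply propext; omega)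
          (fun k hk => by
            by_cases hk2 : k < h₂
            · exact yalt k (by omega)
            · have := hper (k - h₂)
              rw [show h₁ + k = k - h₂ + (h₁ + h₂) by omega, this, Walt' _ (by omega)]
              congr 1; apply propext; omega) n
        rw [hn0] at all
        have := of_decide_eq_false all.symm
        omega
  · -- the word `W'` alternates
    push Not at hcase
    have h2odd : h₂ % 2 = 1 := by
      rcases hend with ⟨e, he, he1⟩ | ⟨k, hk, hk1, hk2⟩
      · rw [(alt e (by omega) (by omega)).2.1] at he1
        have := of_decide_eq_true he1
        omega
      · rw [(alt k (by omega) (by omega)).2.1] at hk1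
        rw [(alt (k + 1) (by omega) (by omega)).2.1] at hk2
        have := of_decide_eq_true hk1
        have := of_decide_eq_true hk2
        omega
    obtain ⟨g, hg⟩ : ∃ g, h₂ = 2 * g + 1 := ⟨h₂ / 2, by omega⟩
    have hn2 : h₂ ≤ n := by
      by_contra hlt
      exact absurd (alt n (by omega) (by omega)).1 (lt_irrefl _)
    obtain ⟨r', hr'⟩ : ∃ r', h₁ = p + h₂ + r' := ⟨h₁ - p - h₂, by omega⟩
    have hwrap : ∀ m, z (h₁ + (h₂ + m)) = z m := by
      intro m
      rw [show h₁ + (h₂ + m) = m + (h₁ + h₂) by ring, hper]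
    have hagree2 : ∀ m, m < n - h₂ → z m = z (p + h₂ + m) := by
      intro m hm
      have := hagree (h₂ + m) (by omega)
      rwa [hwrap, ← add_assoc] at this
    have hn0' : z (n - h₂) = false := by
      rw [← hwrap, show h₁ + (h₂ + (n - h₂)) = h₁ + n by omega, hn0]
    have hn1' : z (p + h₂ + (n - h₂)) = true := by
      rw [show p + h₂ + (n - h₂) = p + n by omega, hn1]
    have hr1 : z (p + h₂ - 1) = true := by
      have := (alt (h₂ - 1) (by omega) (by omega)).2.2
      rw [show p + h₂ - 1 = p + (h₂ - 1) by omega, this]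
      simp; omega
    -- At `n - h₂` the part of `W` from `p + h₂` on would be first to show a 1 against the beginning
    -- of `W`; balancedness forbids this inside `W`. Hence the last `r'` letters of `W` are also its
    -- first `r'`.
    have hlarge : r' ≤ n - h₂ := by
      by_contra hlt
      have := hM (p + h₂) (by omega) (by omega) hr1 (n - h₂) (by omega)
        (fun k hk => (hagree2 k hk).symm) hn1'
      rw [hn0'] at this
      cases this
    -- `W` reads both `P W' R` and `R X P`, where `P` is the border and `R` has length `r'`. So `X`
    -- has as many ones as `W'`, namely `g + 1`, and this extremal count forces `X = W'`.
    have hX : ∀ m < 2 * g + 1, z (r' + m) = decide (m % 2 = 0) := by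
      have key := alternating_of_count (fun m => z (r' + m)) g
        (fun k hk h => no11 (r' + k) (by omega) h)
      apply key.2
      have s1 : ∑ k ∈ Finset.range h₁, (z k).toNat =
          ∑ k ∈ Finset.range p, (z k).toNat + ∑ k ∈ Finset.range h₂, (z (p + k)).toNat +
            ∑ k ∈ Finset.range r', (z (p + h₂ + k)).toNat := by
        rw [hr', Finset.sum_range_add, Finset.sum_range_add]
      have s2 : ∑ k ∈ Finset.range h₁, (z k).toNat =
          ∑ k ∈ Finset.range r', (z k).toNat + ∑ k ∈ Finset.range h₂, (z (r' + k)).toNat +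
            ∑ k ∈ Finset.range p, (z (r' + h₂ + k)).toNat := by
        rw [show h₁ = r' + h₂ + p by omega, Finset.sum_range_add, Finset.sum_range_add]
      have s3 : ∑ k ∈ Finset.range p, (z (r' + h₂ + k)).toNat =
          ∑ k ∈ Finset.range p, (z k).toNat :=
        Finset.sum_congr rfl fun k hk => by
          rw [border k (Finset.mem_range.1 hk), show k + (h₁ - p) = r' + h₂ + k by omega]
      have s4 : ∑ k ∈ Finset.range r', (z (p + h₂ + k)).toNat =
          ∑ k ∈ Finset.range r', (z k).toNat :=
        Finset.sum_congr rfl fun k hk => by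
          rw [hagree2 k (by have := Finset.mem_range.1 hk; omega)]
      have s5 : ∀ g', g' ≤ g →
          ∑ k ∈ Finset.range (2 * g' + 1), (z (p + k)).toNat = g' + 1 := by
        intro g'
        induction g' with
        | zero => simp [zp]
        | succ g' ih =>
          intro hg'
          rw [show 2 * (g' + 1) + 1 = 2 * g' + 1 + 1 + 1 by ring, Finset.sum_range_succ,
            Finset.sum_range_succ, ih (by omega), (alt (2 * g' + 1) (by omega) (by omega)).2.2,
            (alt (2 * g' + 1 + 1) (by omega) (by omega)).2.2,
            show (2 * g' + 1) % 2 = 1 by omega, show (2 * g' + 1 + 1) % 2 = 0 by omega]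
          simp
      have s6 := s5 g le_rfl
      rw [← hg] at s6 ⊢
      omega
    -- The periods are `W' R X P` from `h₁` on and `W' R W' P` from `p` on; they coincide, so there
    -- is no difference at `n`.
    have all := eq_of_periodic_of_eq_lt (f := fun k => z (h₁ + k)) (g := fun k => z (p + k))
      (N := h₁ + h₂) (by omega)
      (fun k => by rw [← add_assoc, hper])
      (fun k => by rw [← add_assoc, hper])
      (fun k hk => by
        by_cases k1 : k < n
        · exact hagree k k1
        obtain ⟨m, rfl⟩ := Nat.exists_eq_add_of_le (by omega : h₂ + r' ≤ k)
        rw [add_assoc, hwrap]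
        by_cases k2 : m < h₂
        · rw [show p + (h₂ + (r' + m)) = h₁ + m by omega, hX m (by omega),
            (alt m (by omega) (by omega)).2.1]
        · obtain ⟨l, rfl⟩ := Nat.exists_eq_add_of_le (by omega : h₂ ≤ m)
          rw [show p + (h₂ + (r' + (h₂ + l))) = h₁ + (h₂ + l) by omega, hwrap,
            border l (by omega)]
          congr 1; omega) n
    rw [hn0, hn1] at all
    cases all

theorem SeqLt.not_iff {f g : ℕ → Bool} :
    SeqLt (fun k => !f k) (fun k => !g k) ↔ SeqLt g f := by
  constructor <;> rintro ⟨n, h, h0, h1⟩ <;> refine ⟨n, fun k hk => ?_, ?_, ?_⟩ <;>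
    simp_all

/-! ### Rotations -/

/-- The orbit of `a` under the rotation `a ↦ a + n mod m + n`. -/
def rot (m n a k : ℕ) : ℕ := (a + k * n) % (m + n)

/-- The labels along the orbit of `a`. -/
def rotLabel (m n a k : ℕ) : Bool := decide (rot m n a k < m)

section Rot

variable {m n a b : ℕ}

theorem rot_lt (ha : a < m + n) (k : ℕ) : rot m n a k < m + n := Nat.mod_lt _ (by omega)

theorem rot_zero (ha : a < m + n) : rot m n a 0 = a := by simp [rot, Nat.mod_eq_of_lt ha]

theorem rot_succ (ha : a < m + n) (k : ℕ) :
    rot m n a (k + 1) = if rot m n a k < m then rot m n a k + n else rot m n a k - m := by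
  have h1 := rot_lt ha k
  have h2 : rot m n a (k + 1) = (rot m n a k + n) % (m + n) := by
    simp only [rot, Nat.mod_add_mod]
    congr 1; ring
  rw [h2]
  split_ifs with h
  · exact Nat.mod_eq_of_lt (by omega)
  · rw [show rot m n a k + n = rot m n a k - m + (m + n) by omega, Nat.add_mod_right]
    exact Nat.mod_eq_of_lt (by omega)

theorem rot_rot (k l : ℕ) : rot m n (rot m n a k) l = rot m n a (k + l) := by
  simp only [rot, Nat.mod_add_mod]
  congr 1; ring

theorem rotLabel_rot (k l : ℕ) : rotLabel m n (rot m n a k) l = rotLabel m n a (k + l) := by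
  simp only [rotLabel, rot_rot]

theorem rot_period (ha : a < m + n) : rot m n a (m + n) = a := by
  rw [rot, Nat.add_mul_mod_self_left, Nat.mod_eq_of_lt ha]

theorem exists_rot_eq (hc : Nat.Coprime m n) (hb : b < m + n) :
    ∃ k < m + n, rot m n a k = b := by
  have hc' : Nat.Coprime n (m + n) := by
    simpa [Nat.coprime_add_self_right] using hc.symm
  by_cases h1 : m + n = 1
  · refine ⟨0, by omega, ?_⟩
    simp only [rot, h1, Nat.mod_one]; omega
  · obtain ⟨d, hd⟩ := Nat.exists_mul_mod_eq_one_of_coprime hc' (by omega)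
    -- `d` inverts `n` modulo `m + n`, so the witness is `(b - a) d`; the multiple of `m + n` keeps
    -- the subtraction from being truncated.
    refine ⟨((b + (m + n) * a - a) * d) % (m + n), Nat.mod_lt _ (by omega), ?_⟩
    have hle : a ≤ (m + n) * a := Nat.le_mul_of_pos_left _ (by omega)
    have e1 : ((b + (m + n) * a - a) * d) % (m + n) * n ≡ b + (m + n) * a - a [MOD m + n] := by
      calc _ ≡ (b + (m + n) * a - a) * d * n [MOD m + n] :=
            (Nat.mod_modEq _ _).mul_right n
        _ = (b + (m + n) * a - a) * (n * d) := by ring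
        _ ≡ (b + (m + n) * a - a) * 1 [MOD m + n] := by
            apply Nat.ModEq.mul_left
            rw [Nat.ModEq, hd.2, Nat.mod_eq_of_lt (by omega)]
        _ = _ := mul_one _
    have e2 := e1.add_left a
    rw [show a + (b + (m + n) * a - a) = b + (m + n) * a by omega] at e2
    rw [rot, e2, Nat.add_mul_mod_self_left, Nat.mod_eq_of_lt hb]

theorem rot_ne (hc : Nat.Coprime m n) (ha : a < m + n) {k : ℕ} (hk : 0 < k) (hk1 : k < m + n) :
    rot m n a k ≠ a := by
  intro h
  have hc' : Nat.Coprime (m + n) n := by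
    simpa [Nat.coprime_add_self_left] using hc
  have h1 : a + k * n ≡ a + 0 [MOD m + n] := by
    rw [Nat.ModEq, ← rot, h, add_zero, Nat.mod_eq_of_lt ha]
  have h2 := Nat.ModEq.add_left_cancel' _ h1
  have h3 := (Nat.modEq_zero_iff_dvd.1 h2)
  have h4 := Nat.le_of_dvd hk (hc'.dvd_of_dvd_mul_right h3)
  omega

/-- Points with the same label move by the same amount, `+n` or `-m`, so their distance stays
constant until the labels differ. -/
theorem rot_add_eq (ha : a < m + n) (hb : b < m + n) (k : ℕ)
    (h : ∀ l < k, rotLabel m n a l = rotLabel m n b l) :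
    rot m n a k + b = rot m n b k + a := by
  induction k with
  | zero => rw [rot_zero ha, rot_zero hb, add_comm]
  | succ k ih =>
    have ih := ih fun l hl => h l (by omega)
    have h1 := h k (by omega)
    simp only [rotLabel, decide_eq_decide] at h1
    rw [rot_succ ha, rot_succ hb]
    split_ifs <;> omega

theorem rotLabel_of_lt (ha : a < m + n) (hab : b < a) (k : ℕ)
    (h : ∀ l < k, rotLabel m n a l = rotLabel m n b l) (h1 : rotLabel m n a k = true) :
    rotLabel m n b k = true := by
  have := rot_add_eq ha (by omega) k h
  simp only [rotLabel, decide_eq_true_eq] at h1 ⊢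
  omega

theorem exists_rotLabel_ne (hc : Nat.Coprime m n) (ha : a < m + n) (hab : b < a) :
    ∃ k < m + n, rotLabel m n a k ≠ rotLabel m n b k := by
  by_contra! h
  have hm : 0 < m := by
    rcases Nat.eq_zero_or_pos m with rfl | h
    · simp at hc; omega
    · exact h
  -- `m - 1` is the last place with label 1: when the smaller orbit is there, the larger one lies
  -- beyond and has label 0.
  obtain ⟨k, hk, hk1⟩ := exists_rot_eq (a := b) (b := m - 1) hc (by omega)
  have h1 := rot_add_eq ha (by omega) k fun l hl => h l (by omega)
  have h2 := h k hk
  simp only [rotLabel, decide_eq_decide] at h2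
  omega

/-- Labels along the orbits of two different points first differ where the larger point has label
`0`. -/
theorem exists_first_rotLabel_ne (hc : Nat.Coprime m n) (ha : a < m + n) (hab : b < a) :
    ∃ k < m + n, (∀ l < k, rotLabel m n a l = rotLabel m n b l) ∧
      rotLabel m n a k = false ∧ rotLabel m n b k = true := by
  have hex := exists_rotLabel_ne hc ha hab
  classical
  have hk := Nat.find_spec hex
  have hl : ∀ l < Nat.find hex, rotLabel m n a l = rotLabel m n b l := fun l hl => by
    by_contra h
    exact Nat.find_min hex hl ⟨by omega, h⟩
  refine ⟨Nat.find hex, hk.1, hl, ?_⟩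
  have h1 := rotLabel_of_lt ha hab _ hl
  have h2 := hk.2
  revert h1 h2
  generalize rotLabel m n a (Nat.find hex) = x
  generalize rotLabel m n b (Nat.find hex) = y
  revert x y
  decide

theorem rotLabel_succ (hmn : m < n) (ha : a < m + n) (k : ℕ) (h : rotLabel m n a k = true) :
    rotLabel m n a (k + 1) = false := by
  simp only [rotLabel, decide_eq_true_eq, decide_eq_false_iff_not] at h ⊢
  rw [rot_succ ha, if_pos h]
  omega

/-- The reflection `a ↦ m + n - 1 - a` exchanges the roles of `m` and `n`, and with them the two
labels. It transfers statements about words without consecutive ones to words without consecutive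
zeros. -/
theorem rot_flip (ha : a < m + n) (k : ℕ) :
    rot n m (m + n - 1 - a) k + rot m n a k + 1 = m + n := by
  induction k with
  | zero => rw [rot_zero (by omega), rot_zero ha]; omega
  | succ k ih =>
    rw [rot_succ (by omega), rot_succ ha]
    have := rot_lt ha k
    split_ifs <;> omega

theorem rotLabel_flip (ha : a < m + n) (k : ℕ) :
    rotLabel n m (m + n - 1 - a) k = !rotLabel m n a k := by
  have := rot_flip ha k
  simp only [rotLabel, ← decide_not, decide_eq_decide]
  omega

theorem rotLabel_succ' (hmn : n < m) (ha : a < m + n) (k : ℕ) (h : rotLabel m n a k = false) :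
    rotLabel m n a (k + 1) = true := by
  have := rotLabel_succ hmn (a := m + n - 1 - a) (by omega) k (by rw [rotLabel_flip ha, h]; rfl)
  rw [rotLabel_flip ha] at this
  simpa using this

/-- If the ones prevail, then somewhere two ones are consecutive. -/
theorem exists_consecutive_ones (hc : Nat.Coprime m n) (hmn : n < m) :
    (∃ e, m + n = e + 1 ∧ rotLabel m n a e = true) ∨
      ∃ k, k + 1 < m + n ∧ rotLabel m n a k = true ∧ rotLabel m n a (k + 1) = true := by
  obtain ⟨k, hk, hk0⟩ := exists_rot_eq (a := a) (b := 0) hc (by omega)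
  have h0 : rotLabel m n a k = true := by simp [rotLabel, hk0]; omega
  by_cases hk1 : k + 1 < m + n
  · refine Or.inr ⟨k, hk1, h0, ?_⟩
    have h1 : rotLabel m n (rot m n a k) 1 = true := by
      rw [hk0, rotLabel, rot, decide_eq_true_eq, zero_add, one_mul, Nat.mod_eq_of_lt (by omega)]
      exact hmn
    rwa [rotLabel_rot] at h1
  · exact Or.inl ⟨k, by omega, h0⟩

end Rot

/-- Label words of rotations satisfy the hypotheses of `not_seqLt_of_border`: the slope inequalities
give the conditions on consecutive letters, monotonicity of the rotation gives balancedness. -/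
theorem not_seqLt_of_rot {m₁ n₁ m₂ n₂ i j : ℕ} (hc₂ : Nat.Coprime m₂ n₂)
    (h₁ : m₁ < n₁) (h₂ : n₂ < m₂) (hi : i < m₁ + n₁) (hi0 : m₁ ≤ i) (hj : j < m₂)
    (z : ℕ → Bool) (hper : ∀ k, z (k + ((m₁ + n₁) + (m₂ + n₂))) = z k)
    (hz₁ : ∀ k < m₁ + n₁, z k = rotLabel m₁ n₁ i k)
    (hz₂ : ∀ k < m₂ + n₂, z (m₁ + n₁ + k) = rotLabel m₂ n₂ j k)
    {p : ℕ} (hp : 0 < p) (hp1 : p < m₁ + n₁)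
    (border : ∀ k < p, z k = rotLabel m₁ n₁ i (k + (m₁ + n₁ - p))) :
    ¬ SeqLt (fun k => z (m₁ + n₁ + k)) (fun k => z (p + k)) := by
  refine not_seqLt_of_border z (m₁ + n₁) (m₂ + n₂) p hp hp1 hper ?_ ?_ ?_ ?_ ?_ ?_ ?_
  · rw [hz₁ _ (by omega), rotLabel, rot_zero hi]; simpa using hi0
  · have := hz₂ 0 (by omega)
    rw [rotLabel, rot_zero (by omega)] at this
    simpa [hj] using this
  · intro k hk h
    rw [hz₁ _ (by omega)] at h ⊢
    exact rotLabel_succ h₁ hi k h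
  · intro k hk h
    rw [hz₂ _ (by omega)] at h ⊢
    exact rotLabel_succ' h₂ (by omega) k h
  · rcases exists_consecutive_ones (a := j) hc₂ h₂ with ⟨e, he, h⟩ | ⟨k, hk, h, h'⟩
    · exact Or.inl ⟨e, he, by rw [hz₂ _ (by omega), h]⟩
    · exact Or.inr ⟨k, hk, by rw [hz₂ _ (by omega), h], by rw [hz₂ _ (by omega), h']⟩
  -- A last label 0 means that `i` is its predecessor minus `m₁`, hence below `n₁`; a label 1 at `r
  -- - 1` puts the `r`-th point at `n₁` or above. So the `r`-th point exceeds `i` and cannot be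
  -- first to show a 1.
  · intro hl r hr hr1 hr2 n hn hag hn1
    rw [hz₁ _ (by omega), rotLabel, decide_eq_false_iff_not] at hl
    rw [hz₁ _ (by omega), rotLabel, decide_eq_true_eq] at hr2
    have e1 := rot_succ hi (m₁ + n₁ - 1)
    rw [Nat.sub_add_cancel (by omega), rot_period hi, if_neg hl] at e1
    have e2 := rot_succ hi (r - 1)
    rw [Nat.sub_add_cancel hr, if_pos hr2] at e2
    have e3 := rot_lt hi (m₁ + n₁ - 1)
    rw [hz₁ _ (by omega)] at hn1 ⊢
    rw [← rotLabel_rot] at hn1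
    refine rotLabel_of_lt (rot_lt hi r) (by omega) n (fun k hk => ?_) hn1
    rw [rotLabel_rot, ← hz₁ _ (by omega), ← hz₁ _ (by omega), hag k hk]
  · intro k hk
    rw [border k hk, hz₁ _ (by omega)]

/-- Complementing labels reverses `SeqLt`, and by reflection makes the second summand play the part
of the first. -/
theorem not_seqLt_of_rot' {m₁ n₁ m₂ n₂ i j : ℕ} (hc₁ : Nat.Coprime m₁ n₁)
    (h₁ : m₁ < n₁) (h₂ : n₂ < m₂) (hi : i < m₁ + n₁) (hi0 : m₁ ≤ i) (hj : j < m₂)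
    (z : ℕ → Bool) (hper : ∀ k, z (k + ((m₂ + n₂) + (m₁ + n₁))) = z k)
    (hz₂ : ∀ k < m₂ + n₂, z k = rotLabel m₂ n₂ j k)
    (hz₁ : ∀ k < m₁ + n₁, z (m₂ + n₂ + k) = rotLabel m₁ n₁ i k)
    {p : ℕ} (hp : 0 < p) (hp1 : p < m₂ + n₂)
    (border : ∀ k < p, z k = rotLabel m₂ n₂ j (k + (m₂ + n₂ - p))) :
    ¬ SeqLt (fun k => z (p + k)) (fun k => z (m₂ + n₂ + k)) := by
  have e1 : n₂ + m₂ = m₂ + n₂ := add_comm _ _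
  have e2 : n₁ + m₁ = m₁ + n₁ := add_comm _ _
  have := not_seqLt_of_rot (i := m₂ + n₂ - 1 - j) (j := m₁ + n₁ - 1 - i) hc₁.symm h₂ h₁
    (by omega) (by omega) (by omega) (fun k => !z k)
    (fun k => by rw [e1, e2, hper])
    (fun k hk => by rw [rotLabel_flip (by omega), hz₂ _ (by omega)])
    (fun k hk => by rw [rotLabel_flip (by omega), e1, hz₁ _ (by omega)])
    hp (by omega) (fun k hk => by rw [rotLabel_flip (by omega), e1, border k hk])
  rw [e1] at this
  rwa [SeqLt.not_iff (f := fun k => z (m₂ + n₂ + k)) (g := fun k => z (p + k))] at this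

noncomputable section
namespace ABS

/-! ### Refining an order by binary expansions -/

section Refine

variable {T : Type*} (o : LinearOrder T) (δ : T → Fin 2) (π : Equiv.Perm T)

/-- The `k`-th relation compares the first `k` digits of the binary expansions, and then uses the
order `o` on the `k`-th preimages. -/
def refineLt : ℕ → T → T → Prop
  | 0 => o.lt
  | k + 1 => fun x y => δ (π.symm x) < δ (π.symm y) ∨
      (δ (π.symm x) = δ (π.symm y) ∧ refineLt k (π.symm x) (π.symm y))

theorem refineLt_total (k : ℕ) {x y : T} (h : x ≠ y) :
    refineLt o δ π k x y ∨ refineLt o δ π k y x := by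
  induction k generalizing x y with
  | zero =>
    let _ := o
    exact lt_or_gt_of_ne h
  | succ k ih =>
    have := ih (π.symm.injective.ne h)
    rcases lt_trichotomy (δ (π.symm x)) (δ (π.symm y)) with h1 | h1 | h1
    · exact Or.inl (Or.inl h1)
    · exact this.imp (fun h => Or.inr ⟨h1, h⟩) (fun h => Or.inr ⟨h1.symm, h⟩)
    · exact Or.inr (Or.inl h1)

theorem refineLt_asymm (k : ℕ) {x y : T} (h : refineLt o δ π k x y) :
    ¬ refineLt o δ π k y x := by
  induction k generalizing x y with
  | zero =>
    let _ := o
    exact lt_asymm (a := x) (b := y) h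
  | succ k ih =>
    rintro (h2 | ⟨h2, h3⟩) <;> rcases h with h | ⟨h, h'⟩
    · exact lt_asymm h h2
    · exact h2.ne h.symm
    · exact h.ne h2.symm
    · exact ih h' h3

/-- The pairs on which the `k`-th and the next relation disagree. -/
def disagree (k : ℕ) : Set (T × T) :=
  {q | refineLt o δ π (k + 1) q.1 q.2 ∧ refineLt o δ π k q.2 q.1}

/-- Both relations look first at the labels of the preimages. If these differ they settle both
comparisons alike, so only reversals with equal labels are passed on. -/
theorem mem_disagree_succ (k : ℕ) (x y : T) :
    (π x, π y) ∈ disagree o δ π (k + 1) ↔ (x, y) ∈ disagree o δ π k ∧ δ x = δ y := by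
  simp only [disagree, Set.mem_ofPred_eq]
  rw [refineLt, refineLt.eq_2 o δ π k]
  simp only [Equiv.symm_apply_apply]
  constructor
  · rintro ⟨h1 | ⟨h1, h2⟩, h3 | ⟨h3, h4⟩⟩
    · exact absurd h1 h3.asymm
    · exact absurd h3 h1.ne'
    · exact absurd h1 h3.ne'
    · exact ⟨⟨h2, h4⟩, h1⟩
  · rintro ⟨⟨h1, h2⟩, h3⟩
    exact ⟨Or.inr ⟨h3, h1⟩, Or.inr ⟨h3.symm, h2⟩⟩

theorem mem_disagree (k : ℕ) (x y : T) :
    ((π ^ k) x, (π ^ k) y) ∈ disagree o δ π k ↔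
      (x, y) ∈ disagree o δ π 0 ∧ ∀ l < k, δ ((π ^ l) x) = δ ((π ^ l) y) := by
  induction k with
  | zero => simp
  | succ k ih =>
    rw [pow_succ', Equiv.Perm.mul_apply, Equiv.Perm.mul_apply, mem_disagree_succ, ih, and_assoc]
    refine and_congr_right fun _ => ⟨fun h l hl => ?_, fun h => ⟨fun l hl => h l (by omega),
      h k (by omega)⟩⟩
    rcases Nat.lt_succ_iff_lt_or_eq.1 hl with hl | rfl
    · exact h.1 l hl
    · exact h.2

/-- The length with respect to the `k`-th relation. -/
def refineLength (k : ℕ) : ℕ :=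
  {q : T × T | δ q.1 = 0 ∧ δ q.2 = 1 ∧ refineLt o δ π k q.1 q.2}.ncard

/-- A reversal with labels `(0, 1)` is a newly counted pair; one with labels `(1, 0)` is a pair no
longer counted. -/
theorem refineLength_succ [Finite T] (k : ℕ) :
    refineLength o δ π (k + 1) + {q ∈ disagree o δ π k | δ q.1 = 1 ∧ δ q.2 = 0}.ncard =
      refineLength o δ π k + {q ∈ disagree o δ π k | δ q.1 = 0 ∧ δ q.2 = 1}.ncard := by
  have h1 : {q ∈ disagree o δ π k | δ q.1 = 1 ∧ δ q.2 = 0}.ncard =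
      (Prod.swap '' {q ∈ disagree o δ π k | δ q.1 = 1 ∧ δ q.2 = 0}).ncard :=
    (Set.ncard_image_of_injective _ Prod.swap_injective).symm
  rw [h1, refineLength, refineLength, ← Set.ncard_union_eq, ← Set.ncard_union_eq]
  · congr 1
    ext ⟨x, y⟩
    simp only [Set.mem_union, Set.mem_ofPred_eq, disagree, Set.image_swap_eq_preimage_swap,
      Set.mem_preimage, Prod.swap_prod_mk]
    constructor
    · rintro (⟨h1, h2, h3⟩ | ⟨⟨h1, h2⟩, h3, h4⟩)
      · by_cases h4 : refineLt o δ π k x y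
        · exact Or.inl ⟨h1, h2, h4⟩
        · refine Or.inr ⟨⟨h3, (refineLt_total o δ π k ?_).resolve_left h4⟩, h1, h2⟩
          rintro rfl; rw [h1] at h2; cases h2
      · exact Or.inl ⟨h4, h3, h2⟩
    · rintro (⟨h1, h2, h3⟩ | ⟨⟨h1, h2⟩, h3, h4⟩)
      · by_cases h4 : refineLt o δ π (k + 1) x y
        · exact Or.inl ⟨h1, h2, h4⟩
        · refine Or.inr ⟨⟨(refineLt_total o δ π (k + 1) ?_).resolve_left h4, h3⟩, h2, h1⟩
          rintro rfl; rw [h1] at h2; cases h2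
      · exact Or.inl ⟨h3, h4, h1⟩
  · rw [Set.disjoint_left]
    rintro ⟨x, y⟩ ⟨_, _, h⟩ ⟨⟨_, h'⟩, _⟩
    exact refineLt_asymm _ _ _ _ h h'
  · rw [Set.disjoint_left]
    rintro ⟨x, y⟩ ⟨_, _, h⟩ h'
    rw [Set.image_swap_eq_preimage_swap] at h'
    exact refineLt_asymm _ _ _ _ h h'.1.1

theorem ncard_disagree_succ (k : ℕ) :
    (disagree o δ π (k + 1)).ncard = {q ∈ disagree o δ π k | δ q.1 = δ q.2}.ncard := by
  refine Eq.trans ?_ (Set.ncard_image_of_injective _ (π.injective.prodMap π.injective))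
  congr 1
  ext ⟨x, y⟩
  constructor
  · intro h
    refine ⟨(π.symm x, π.symm y), ?_, by simp⟩
    exact (mem_disagree_succ o δ π k _ _).1 (by simpa using h)
  · rintro ⟨⟨x', y'⟩, h, h'⟩
    simp only [Prod.map_apply, Prod.mk.injEq] at h'
    rw [← h'.1, ← h'.2]
    exact (mem_disagree_succ o δ π k _ _).2 h

theorem ncard_disagree [Finite T] (k : ℕ) :
    (disagree o δ π k).ncard = {q ∈ disagree o δ π k | δ q.1 = 0 ∧ δ q.2 = 1}.ncard +
      {q ∈ disagree o δ π k | δ q.1 = 1 ∧ δ q.2 = 0}.ncard +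
      {q ∈ disagree o δ π k | δ q.1 = δ q.2}.ncard := by
  rw [← Set.ncard_union_eq, ← Set.ncard_union_eq]
  · congr 1
    ext ⟨x, y⟩
    simp only [Set.mem_union, Set.mem_ofPred_eq, ← and_or_left]
    refine ⟨fun h => ⟨h, ?_⟩, fun h => h.1⟩
    generalize δ x = a
    generalize δ y = b
    revert a b
    decide
  · rw [Set.disjoint_left]
    rintro ⟨x, y⟩ (⟨_, h1, h2⟩ | ⟨_, h1, h2⟩) ⟨_, h3⟩ <;> simp_all
  · rw [Set.disjoint_left]
    rintro ⟨x, y⟩ ⟨_, h1, h2⟩ ⟨_, h3, h4⟩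
    simp_all

/-- A reversal with equal labels survives, and one with labels `(0, 1)` is traded for a unit of
length. Labels `(1, 0)` cost two: the reversal and a unit of length. -/
theorem refineLength_add_ncard [Finite T] (k : ℕ) :
    refineLength o δ π (k + 1) + (disagree o δ π (k + 1)).ncard +
      2 * {q ∈ disagree o δ π k | δ q.1 = 1 ∧ δ q.2 = 0}.ncard =
    refineLength o δ π k + (disagree o δ π k).ncard := by
  have h1 := refineLength_succ o δ π k
  have h2 := ncard_disagree_succ o δ π k
  have h3 := ncard_disagree o δ π k
  omega

theorem refineLt_of_digits {k r : ℕ} (hr : r < k) {x y : T}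
    (h : ∀ l < r, binExp δ π x l = binExp δ π y l)
    (h1 : binExp δ π x r < binExp δ π y r) : refineLt o δ π k x y := by
  have hb : ∀ (x : T) (l : ℕ), binExp δ π x (l + 1) = binExp δ π (π.symm x) l := by
    intro x l
    change δ ((π ^ (l + 1 + 1)).symm x) = δ ((π ^ (l + 1)).symm (π.symm x))
    rw [pow_succ']
    rfl
  induction k generalizing r x y with
  | zero => omega
  | succ k ih =>
    cases r with
    | zero => exact Or.inl (by simpa [binExp] using h1)
    | succ r =>
      refine Or.inr ⟨by simpa [binExp] using h 0 (by omega), ?_⟩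
      rw [hb, hb] at h1
      refine ih (by omega) (fun l hl => ?_) h1
      rw [← hb, ← hb, h _ (by omega)]

/-- For elements with different labels, `refineLt` is eventually the comparison of the binary
expansions. -/
theorem refineLt_iff_binExp_lt [Finite T] {k : ℕ} (hk : orderOf π ≤ k) {x y : T}
    (h : δ x ≠ δ y) : refineLt o δ π k x y ↔ binExp δ π x < binExp δ π y := by
  have hO : 0 < orderOf π := orderOf_pos π
  -- Digits are indexed from 0, so at index `orderOf π - 1` the power of `π` is trivial and the
  -- digit is the element's own label.
  have hd : ∀ x, binExp δ π x (orderOf π - 1) = δ x := by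
    intro x
    change δ ((π ^ (orderOf π - 1 + 1)).symm x) = δ x
    rw [Nat.sub_add_cancel hO, pow_orderOf_eq_one]
    rfl
  have hex : ∃ r, binExp δ π x r ≠ binExp δ π y r := ⟨orderOf π - 1, by rwa [hd, hd]⟩
  classical
  have hr := Nat.find_spec hex
  have hl : ∀ l < Nat.find hex, binExp δ π x l = binExp δ π y l :=
    fun l hl => not_not.1 (Nat.find_min hex hl)
  have hrk : Nat.find hex < k := by
    have := Nat.find_min' hex (m := orderOf π - 1) (by rwa [hd, hd])
    omega
  rcases lt_or_gt_of_ne hr with h1 | h1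
  · exact iff_of_true (refineLt_of_digits o δ π hrk hl h1) ⟨_, hl, h1⟩
  · refine iff_of_false (refineLt_asymm _ _ _ _ (refineLt_of_digits o δ π hrk
      (fun l h => (hl l h).symm) h1)) (lt_asymm ?_)
    exact ⟨_, fun l h => (hl l h).symm, h1⟩

/-- Only pairs with different labels count, and these have different expansions; the order among
equal expansions is immaterial. -/
theorem length_eq_refineLength [Finite T] (S : ABS T) (hS : OrderedByExp S.ord S.δ S.π) {k : ℕ}
    (hk : orderOf S.π ≤ k) : S.length = refineLength o S.δ S.π k := by
  rw [length, refineLength]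
  congr 1
  ext ⟨x, y⟩
  refine and_congr_right fun h1 => and_congr_right fun h2 => ?_
  have h1 : S.δ x = 0 := h1
  have h2 : S.δ y = 1 := h2
  have hne : S.δ x ≠ S.δ y := by rw [h1, h2]; decide
  rw [refineLt_iff_binExp_lt o S.δ S.π hk hne]
  have hex : binExp S.δ S.π x ≠ binExp S.δ S.π y := fun h => by
    have e1 := (refineLt_iff_binExp_lt o S.δ S.π hk hne).not.2 h.not_lt
    have e2 := (refineLt_iff_binExp_lt o S.δ S.π hk hne.symm).not.2 h.not_gt
    exact (refineLt_total o S.δ S.π k fun h => hne (congrArg S.δ h)).elim e1 e2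
  constructor
  · exact fun h => lt_of_le_of_ne (hS x y h) hex
  · intro h
    let _ := S.ord
    by_contra h'
    rcases lt_trichotomy x y with h3 | h3 | h3
    · exact h' h3
    · exact hne (congrArg S.δ h3)
    · exact absurd (hS y x h3) (not_le_of_gt h)

end Refine

/-! ### The length after an exchange -/

section Exchange

variable {T : Type*}

/-- The labels along the forward orbit of `x`. -/
def forward (δ : T → Fin 2) (π : Equiv.Perm T) (x : T) (k : ℕ) : Bool := decide (δ ((π ^ k) x) = 1)

theorem forward_eq_iff {δ : T → Fin 2} {π : Equiv.Perm T} {x y : T} {k l : ℕ} :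
    forward δ π x k = forward δ π y l ↔ δ ((π ^ k) x) = δ ((π ^ l) y) := by
  simp only [forward, decide_eq_decide]
  generalize δ ((π ^ k) x) = a
  generalize δ ((π ^ l) y) = b
  revert a b
  decide

theorem forward_eq_false_iff {δ : T → Fin 2} {π : Equiv.Perm T} {x : T} {k : ℕ} :
    forward δ π x k = false ↔ δ ((π ^ k) x) = 0 := by
  simp only [forward, decide_eq_false_iff_not]
  generalize δ ((π ^ k) x) = a
  revert a
  decide

theorem forward_eq_true_iff {δ : T → Fin 2} {π : Equiv.Perm T} {x : T} {k : ℕ} :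
    forward δ π x k = true ↔ δ ((π ^ k) x) = 1 := by
  simp [forward]

/-- `S.ord` orders the images under `π` by label first, and then as their preimages. -/
def IsCompatible (S : ABS T) : Prop :=
  ∀ x y, S.ord.lt (S.π x) (S.π y) ↔ S.δ x < S.δ y ∨ (S.δ x = S.δ y ∧ S.ord.lt x y)

variable [DecidableEq T]

/-- Compatibility turns the comparison of preimages into the order of `S` on images under the old
bijection, so the first relation is `S` with `s` and `t` interchanged. -/
theorem refineLt_one_smallMod (S : ABS T) (hS : S.IsCompatible) (s t x y : T) :
    refineLt S.ord S.δ (smallMod S.π s t) 1 x y ↔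
      S.ord.lt (Equiv.swap s t x) (Equiv.swap s t y) := by
  have h : ∀ x, (smallMod S.π s t).symm x = S.π.symm (Equiv.swap s t x) := by
    intro x
    simp [smallMod]
  simp only [refineLt, h]
  rw [← hS, Equiv.apply_symm_apply, Equiv.apply_symm_apply]

theorem mem_disagree_zero (S : ABS T) (hS : S.IsCompatible) {s t : T} (hst : S.ord.lt s t)
    (x y : T) : (x, y) ∈ disagree S.ord S.δ (smallMod S.π s t) 0 ↔
      (x = t ∧ y = s) ∨ (x = t ∧ S.ord.lt s y ∧ S.ord.lt y t) ∨
        (y = s ∧ S.ord.lt s x ∧ S.ord.lt x t) := by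
  rw [disagree, Set.mem_ofPred_eq, zero_add, refineLt_one_smallMod S hS, refineLt]
  let _ := S.ord
  change s < t at hst
  change (Equiv.swap s t x < Equiv.swap s t y ∧ y < x) ↔
    (x = t ∧ y = s) ∨ (x = t ∧ s < y ∧ y < t) ∨ (y = s ∧ s < x ∧ x < t)
  have := hst.ne
  rw [Equiv.swap_apply_def, Equiv.swap_apply_def]
  split_ifs <;> grind

/-- Each element strictly between `s` and `t` lies in one reversal with equal labels and one with
labels `(1, 0)`; the pair `(t, s)` is the extra one. -/
theorem ncard_disagree_zero [Finite T] (S : ABS T) (hS : S.IsCompatible) {s t : T}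
    (hst : S.ord.lt s t) (hs : S.δ s = 0) (ht : S.δ t = 1) :
    {q ∈ disagree S.ord S.δ (smallMod S.π s t) 0 | S.δ q.1 = 1 ∧ S.δ q.2 = 0}.ncard =
      {q ∈ disagree S.ord S.δ (smallMod S.π s t) 0 | S.δ q.1 = S.δ q.2}.ncard + 1 := by
  have hne : s ≠ t := by let _ := S.ord; exact ne_of_lt hst
  have key : ∀ w, S.δ w = 0 ∨ S.δ w = 1 := fun w => by
    generalize S.δ w = a
    revert a
    decide
  have e1 : {q ∈ disagree S.ord S.δ (smallMod S.π s t) 0 | S.δ q.1 = S.δ q.2} =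
      (fun w => if S.δ w = 0 then (w, s) else (t, w)) '' {w | S.ord.lt s w ∧ S.ord.lt w t} := by
    ext ⟨x, y⟩
    rw [Set.mem_ofPred_eq, mem_disagree_zero S hS hst]
    constructor
    · rintro ⟨⟨rfl, rfl⟩ | ⟨rfl, h⟩ | ⟨rfl, h⟩, h'⟩
      · simp_all
      · have hy : S.δ y ≠ 0 := by rw [← h', ht]; decide
        exact ⟨y, h, if_neg hy⟩
      · exact ⟨x, h, if_pos (h'.trans hs)⟩
    · rintro ⟨w, ⟨h1, h2⟩, h⟩
      rcases key w with hw | hw <;> simp only [hw, if_true, one_ne_zero, if_false,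
        Prod.mk.injEq] at h <;> obtain ⟨rfl, rfl⟩ := h <;> simp_all
  have e2 : {q ∈ disagree S.ord S.δ (smallMod S.π s t) 0 | S.δ q.1 = 1 ∧ S.δ q.2 = 0} =
      insert (t, s) ((fun w => if S.δ w = 0 then (t, w) else (w, s)) ''
        {w | S.ord.lt s w ∧ S.ord.lt w t}) := by
    ext ⟨x, y⟩
    rw [Set.mem_ofPred_eq, mem_disagree_zero S hS hst, Set.mem_insert_iff]
    constructor
    · rintro ⟨⟨rfl, rfl⟩ | ⟨rfl, h⟩ | ⟨rfl, h⟩, h1, h2⟩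
      · simp
      · exact Or.inr ⟨y, h, by simp_all⟩
      · exact Or.inr ⟨x, h, by simp_all⟩
    · rintro (h | ⟨w, ⟨h1, h2⟩, h⟩)
      · simp only [Prod.mk.injEq] at h
        obtain ⟨rfl, rfl⟩ := h
        simp_all
      · rcases key w with hw | hw <;> simp only [hw, if_true, one_ne_zero, if_false,
          Prod.mk.injEq] at h <;> obtain ⟨rfl, rfl⟩ := h <;> simp_all
  have hlt : ∀ w, ¬ S.ord.lt w w := by
    let _ := S.ord
    exact fun w => lt_irrefl w
  have hinj1 : Set.InjOn (fun w => if S.δ w = 0 then (w, s) else (t, w))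
      {w | S.ord.lt s w ∧ S.ord.lt w t} := by
    rintro w ⟨h1, h2⟩ w' ⟨h3, h4⟩ h
    dsimp only at h
    split_ifs at h <;> simp_all
  have hinj2 : Set.InjOn (fun w => if S.δ w = 0 then (t, w) else (w, s))
      {w | S.ord.lt s w ∧ S.ord.lt w t} := by
    rintro w ⟨h1, h2⟩ w' ⟨h3, h4⟩ h
    dsimp only at h
    split_ifs at h <;> simp_all
  rw [e1, e2, Set.ncard_insert_of_notMem, hinj1.ncard_image, hinj2.ncard_image]
  rintro ⟨w, ⟨h1, h2⟩, h⟩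
  dsimp only at h
  split_ifs at h <;> simp only [Prod.mk.injEq] at h
  · rw [h.2] at h1; exact hlt _ h1
  · rw [h.1] at h2; exact hlt _ h2

/-- An exchange lowers the length by exactly one if and only if the forward label sequences of `s`
and `t` compare in the expected way with those of the elements between `s` and `t`. -/
theorem length_exchange_iff [Finite T] (S : ABS T) (hS : S.IsCompatible) {s t : T}
    (hst : S.ord.lt s t) (hs : S.δ s = 0) (ht : S.δ t = 1) (S' : ABS T)
    (hS' : IsExchange S s t S') :
    S'.length + 1 = S.length ↔
      (∀ u, S.δ u = 0 → S.ord.lt s u → S.ord.lt u t →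
        SeqLt (forward S.δ (smallMod S.π s t) u) (forward S.δ (smallMod S.π s t) s)) ∧
      (∀ w, S.δ w = 1 → S.ord.lt s w → S.ord.lt w t →
        SeqLt (forward S.δ (smallMod S.π s t) t) (forward S.δ (smallMod S.π s t) w)) := by
  set π := smallMod S.π s t with hπ
  have hlen : ∀ k, orderOf π ≤ k → S'.length = refineLength S.ord S.δ π k := by
    intro k hk
    have := length_eq_refineLength S.ord S' hS'.ordered (k := k) (by rwa [hS'.π_eq])
    rwa [hS'.δ_eq, hS'.π_eq] at this
  -- The first step gains no pair and loses one more than the number of surviving reversals.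
  have h0 : refineLength S.ord S.δ π 1 + (disagree S.ord S.δ π 1).ncard + 1 = S.length := by
    have h1 := refineLength_succ S.ord S.δ π 0
    have h2 := ncard_disagree_succ S.ord S.δ π 0
    have h3 := ncard_disagree_zero S hS hst hs ht
    rw [zero_add] at h1 h2
    have h4 : {q ∈ disagree S.ord S.δ π 0 | S.δ q.1 = 0 ∧ S.δ q.2 = 1} = ∅ := by
      ext ⟨x, y⟩
      rw [Set.mem_ofPred_eq, mem_disagree_zero S hS hst]
      simp only [Set.mem_empty_iff_false, iff_false]
      rintro ⟨⟨rfl, rfl⟩ | ⟨rfl, h⟩ | ⟨rfl, h⟩, h1, h2⟩ <;> simp_all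
    rw [h4, Set.ncard_empty] at h1
    have h5 : refineLength S.ord S.δ π 0 = S.length := rfl
    rw [← hπ] at h3
    omega
  have hgood : (∀ u, S.δ u = 0 → S.ord.lt s u → S.ord.lt u t →
        SeqLt (forward S.δ π u) (forward S.δ π s)) ∧
      (∀ w, S.δ w = 1 → S.ord.lt s w → S.ord.lt w t →
        SeqLt (forward S.δ π t) (forward S.δ π w)) ↔
      ∀ x y, (x, y) ∈ disagree S.ord S.δ π 0 → S.δ x = S.δ y →
        SeqLt (forward S.δ π x) (forward S.δ π y) := by
    constructor
    · rintro ⟨h1, h2⟩ x y hxy hd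
      rcases (mem_disagree_zero S hS hst x y).1 hxy with ⟨rfl, rfl⟩ | ⟨rfl, h⟩ | ⟨rfl, h⟩
      · rw [hs, ht] at hd; cases hd
      · exact h2 y (hd ▸ ht) h.1 h.2
      · exact h1 x (hd ▸ hs) h.1 h.2
    · intro h
      exact ⟨fun u hu h1 h2 => h u s ((mem_disagree_zero S hS hst _ _).2 (Or.inr (Or.inr
          ⟨rfl, h1, h2⟩))) (by rw [hu, hs]),
        fun w hw h1 h2 => h t w ((mem_disagree_zero S hS hst _ _).2 (Or.inr (Or.inl
          ⟨rfl, h1, h2⟩))) (by rw [hw, ht])⟩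
  rw [hgood]
  have hmono : ∀ k l, 1 ≤ k → k ≤ l → refineLength S.ord S.δ π l + (disagree S.ord S.δ π l).ncard ≤
      refineLength S.ord S.δ π k + (disagree S.ord S.δ π k).ncard := by
    intro k l hk hl
    induction l, hl using Nat.le_induction with
    | base => exact le_rfl
    | succ l _ ih =>
      have := refineLength_add_ncard S.ord S.δ π l
      omega
  have hrep : ∀ k (q : T × T), q ∈ disagree S.ord S.δ π k → ∃ x y, q = ((π ^ k) x, (π ^ k) y) ∧
      (x, y) ∈ disagree S.ord S.δ π 0 ∧ ∀ l < k, S.δ ((π ^ l) x) = S.δ ((π ^ l) y) := by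
    rintro k ⟨x, y⟩ h
    refine ⟨(π ^ k).symm x, (π ^ k).symm y, by simp, ?_⟩
    rw [← mem_disagree]
    simpa using h
  constructor
  · intro hl x y hxy hd
    by_contra hbad
    by_cases hex : ∃ k, S.δ ((π ^ k) x) ≠ S.δ ((π ^ k) y)
    · classical
      have hk := Nat.find_spec hex
      have hmin : ∀ l < Nat.find hex, S.δ ((π ^ l) x) = S.δ ((π ^ l) y) :=
        fun l hl => not_not.1 (Nat.find_min hex hl)
      have hpos : 1 ≤ Nat.find hex := by
        rw [Nat.one_le_iff_ne_zero]
        intro h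
        rw [h] at hk
        exact hk hd
      -- A first difference in the wrong direction is a loss at that stage; the two units it costs
      -- are never recovered.
      have hmem : ((π ^ (Nat.find hex)) x, (π ^ (Nat.find hex)) y) ∈
          {q ∈ disagree S.ord S.δ π (Nat.find hex) | S.δ q.1 = 1 ∧ S.δ q.2 = 0} := by
        refine ⟨(mem_disagree S.ord S.δ π _ x y).2 ⟨hxy, hmin⟩, ?_⟩
        have hb : ¬ (S.δ ((π ^ (Nat.find hex)) x) = 0 ∧ S.δ ((π ^ (Nat.find hex)) y) = 1) :=
          fun h => hbad ⟨_, fun l hl => forward_eq_iff.2 (hmin l hl),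
            forward_eq_false_iff.2 h.1, forward_eq_true_iff.2 h.2⟩
        dsimp only
        revert hk hb
        generalize S.δ ((π ^ (Nat.find hex)) x) = a
        generalize S.δ ((π ^ (Nat.find hex)) y) = b
        revert a b
        decide
      have hc := (Set.ncard_pos).2 ⟨_, hmem⟩
      have h1 := refineLength_add_ncard S.ord S.δ π (Nat.find hex)
      have h2 := hmono 1 _ le_rfl hpos
      have h3 := hmono (Nat.find hex + 1) (Nat.find hex + 1 + orderOf π) (by omega) (by omega)
      have h4 := hlen (Nat.find hex + 1 + orderOf π) (by omega)
      omega
    -- With labels equal forever the reversal survives every stage, so the length stays strictly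
    -- below the sum.
    · push Not at hex
      have hmem := (mem_disagree S.ord S.δ π (orderOf π + 1) x y).2 ⟨hxy, fun l _ => hex l⟩
      have hc := (Set.ncard_pos).2 ⟨_, hmem⟩
      have h2 := hmono 1 (orderOf π + 1) le_rfl (by omega)
      have h4 := hlen (orderOf π + 1) (by omega)
      omega
  · intro h
    have h10 : ∀ k, {q ∈ disagree S.ord S.δ π (k + 1) | S.δ q.1 = 1 ∧ S.δ q.2 = 0} = ∅ := by
      intro k
      rw [Set.eq_empty_iff_forall_notMem]
      rintro q ⟨hq, h1, h2⟩
      obtain ⟨x, y, rfl, hxy, hl⟩ := hrep _ q hq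
      obtain ⟨r, hr, hr0, hr1⟩ := h x y hxy (by simpa using hl 0 (by omega))
      rw [forward_eq_false_iff] at hr0
      rw [forward_eq_true_iff] at hr1
      rcases lt_trichotomy r (k + 1) with h3 | rfl | h3
      · have := hl r h3
        rw [hr0, hr1] at this
        cases this
      · rw [hr0] at h1; cases h1
      · have := forward_eq_iff.1 (hr _ h3)
        dsimp only at h1 h2
        rw [h1, h2] at this; cases this
    have hconst : ∀ k, refineLength S.ord S.δ π (k + 1) + (disagree S.ord S.δ π (k + 1)).ncard =
        refineLength S.ord S.δ π 1 + (disagree S.ord S.δ π 1).ncard := by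
      intro k
      induction k with
      | zero => rfl
      | succ k ih =>
        have := refineLength_add_ncard S.ord S.δ π (k + 1)
        rw [h10, Set.ncard_empty] at this
        omega
    -- Each of the finitely many reversals ends where its labels first differ; beyond a common bound
    -- none is left.
    have hev : ∃ K, ∀ k, K ≤ k → disagree S.ord S.δ π (k + 1) = ∅ := by
      choose! r hr using fun q : T × T => fun hq : q ∈ disagree S.ord S.δ π 0 ∧ S.δ q.1 = S.δ q.2 =>
        h q.1 q.2 hq.1 hq.2
      obtain ⟨K, hK⟩ := (Set.finite_range r).bddAbove
      refine ⟨K, fun k hk => ?_⟩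
      rw [Set.eq_empty_iff_forall_notMem]
      intro q hq
      obtain ⟨x, y, rfl, hxy, hl⟩ := hrep _ q hq
      obtain ⟨-, hr0, hr1⟩ := hr (x, y) ⟨hxy, by simpa using hl 0 (by omega)⟩
      rw [forward_eq_false_iff] at hr0
      rw [forward_eq_true_iff] at hr1
      have hrK : r (x, y) ≤ K := hK (Set.mem_range_self _)
      have := hl (r (x, y)) (by omega)
      dsimp only at hr0 hr1
      rw [hr0, hr1] at this
      cases this
    obtain ⟨K, hK⟩ := hev
    have h1 := hconst (K + orderOf π)
    rw [hK (K + orderOf π) (by omega), Set.ncard_empty] at h1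
    have h4 := hlen (K + orderOf π + 1) (by omega)
    omega

end Exchange

end ABS
end

noncomputable section
namespace ABS

/-! ### One step of the two processes -/

section Step

variable {T : Type*}

theorem moveRight_lt (o : LinearOrder T) {c u : T} (hcu : o.lt c u) (x y : T) :
    (moveRight o c u).lt x y ↔
      (o.lt x y ∧ ¬ (x = c ∧ o.le y u)) ∨ (y = c ∧ o.lt c x ∧ o.le x u) := by
  classical
  let _ := o
  change (if x = c then toLex (u, true) else toLex (x, false)) <
    (if y = c then toLex (u, true) else toLex (y, false)) ↔
      (x < y ∧ ¬ (x = c ∧ y ≤ u)) ∨ (y = c ∧ c < x ∧ x ≤ u)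
  change c < u at hcu
  have e1 : (false < true) = True := by decide
  have e2 : (true < false) = False := by decide
  split_ifs with hx hy hy <;> simp only [Prod.Lex.toLex_lt_toLex, e1, e2] <;> grind

theorem moveLeft_lt (o : LinearOrder T) {c u : T} (huc : o.lt u c) (x y : T) :
    (moveLeft o c u).lt x y ↔
      (o.lt x y ∧ ¬ (y = c ∧ o.le u x)) ∨ (x = c ∧ o.le u y ∧ o.lt y c) := by
  classical
  let _ := o
  change (if x = c then toLex (u, false) else toLex (x, true)) <
    (if y = c then toLex (u, false) else toLex (y, true)) ↔
      (x < y ∧ ¬ (y = c ∧ u ≤ x)) ∨ (x = c ∧ u ≤ y ∧ y < c)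
  change u < c at huc
  have e1 : (false < true) = True := by decide
  have e2 : (true < false) = False := by decide
  split_ifs with hx hy hy <;> simp only [Prod.Lex.toLex_lt_toLex, e1, e2] <;> grind

theorem label_cases (a : Fin 2) : a = 0 ∨ a = 1 := by
  revert a
  decide

/-- The elements of `L` which form with `α` a pair of equally labelled elements, to the left of
`α`, whose order is reversed by `π`. -/
def leftOf (o : LinearOrder T) (δ : T → Fin 2) (π : Equiv.Perm T) (L : Set T) (α : T) : Set T :=
  {x | x ∈ L ∧ o.lt x α ∧ o.lt (π α) (π x) ∧ δ x = δ α}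

/-- The elements which form with `β` a pair of equally labelled elements, to the right of
`β`, whose order is reversed by `π`. -/
def rightOf (o : LinearOrder T) (δ : T → Fin 2) (π : Equiv.Perm T) (β : T) : Set T :=
  {x | o.lt β x ∧ o.lt (π x) (π β) ∧ δ x = δ β}

/-- The invariant of the first process: `π` reverses the order of equally labelled elements
only for pairs starting with `t`, or ending with `α` and starting in `L`. -/
structure LeftInv (o : LinearOrder T) (δ : T → Fin 2) (π : Equiv.Perm T) (L : Set T) (t α : T) :
    Prop where
  zero_one : ∀ x y, δ x = 0 → δ y = 1 → o.lt (π x) (π y)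
  reversed : ∀ x y, δ x = δ y → o.lt x y → o.lt (π y) (π x) → x = t ∨ (y = α ∧ x ∈ L)
  ones : ∀ x ∈ L, δ x = 1 → o.lt t x → o.lt (π x) (π t)

/-- The invariant of the second process: `π` reverses the order of equally labelled elements
only for pairs starting with `β`. -/
structure RightInv (o : LinearOrder T) (δ : T → Fin 2) (π : Equiv.Perm T) (β : T) :
    Prop where
  zero_one : ∀ x y, δ x = 0 → δ y = 1 → o.lt (π x) (π y)
  reversed : ∀ x y, δ x = δ y → o.lt x y → o.lt (π y) (π x) → x = β

variable {o : LinearOrder T} {δ : T → Fin 2} {π : Equiv.Perm T} {L : Set T} {t α β : T}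

theorem lt_or_lt (o : LinearOrder T) {x y : T} (h : x ≠ y) : o.lt x y ∨ o.lt y x := by
  let _ := o
  exact lt_or_gt_of_ne h

theorem not_lt_of_lt (o : LinearOrder T) {x y : T} (h : o.lt x y) : ¬ o.lt y x := by
  let _ := o
  exact lt_asymm h

theorem le_iff_eq_or_lt' (o : LinearOrder T) {x y : T} : o.le x y ↔ x = y ∨ o.lt x y := by
  let _ := o
  exact le_iff_eq_or_lt

theorem ne_of_lt' (o : LinearOrder T) {x y : T} (h : o.lt x y) : x ≠ y := by
  let _ := o
  exact ne_of_lt h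

theorem lt_trans' (o : LinearOrder T) {x y z : T} (h : o.lt x y) (h' : o.lt y z) : o.lt x z := by
  let _ := o
  exact lt_trans h h'

/-- The move must carry `π α` past exactly the images of the elements reversed with `α`. Images of
zeros precede those of ones, so the interval contains only images of elements labelled like `α`. Any
other preimage would form a reversal that the invariant forbids; the clause `ones` excludes `t`. -/
theorem LeftInv.between_iff (h : LeftInv o δ π L t α) (htL : t ∉ L) (hδt : δ t = 1)
    (hαt : α ≠ t) {u : T} (hu : u ∈ leftOf o δ π L α)
    (hmax : ∀ v ∈ leftOf o δ π L α, o.le v u) (w : T) :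
    (o.lt (π α) w ∧ o.le w (π u)) ↔ w ∈ π '' leftOf o δ π L α := by
  obtain ⟨huL, huα, hπu, hδu⟩ := hu
  constructor
  · obtain ⟨v, rfl⟩ := π.surjective w
    rintro ⟨h1, h2⟩
    refine ⟨v, ?_, rfl⟩
    rw [le_iff_eq_or_lt'] at h2
    rcases h2 with h2 | h2
    · rw [π.injective h2]; exact ⟨huL, huα, hπu, hδu⟩
    have hδv : δ v = δ α := by
      rcases label_cases (δ v) with hv | hv <;> rcases label_cases (δ α) with ha | ha
      · rw [hv, ha]
      · exact absurd h1 (not_lt_of_lt o (h.zero_one v α hv ha))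
      · exact absurd h2 (not_lt_of_lt o (h.zero_one u v (hδu.trans ha) hv))
      · rw [hv, ha]
    have hvα : v ≠ α := fun e => ne_of_lt' o h1 (by rw [e])
    rcases lt_or_lt o hvα with h3 | h3
    · rcases h.reversed v α hδv h3 h1 with rfl | ⟨_, h4⟩
      · have hut : u ≠ v := fun e => htL (e ▸ huL)
        rcases lt_or_lt o hut with h5 | h5
        · rcases h.reversed u v (hδu.trans hδv.symm) h5 h2 with h6 | ⟨h6, _⟩
          · exact absurd h6 hut
          · exact absurd h6 hvα
        · exact absurd h2 (not_lt_of_lt o (h.ones u huL (hδu.trans (hδv.symm.trans hδt)) h5))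
      · exact ⟨h4, h3, h1, hδv⟩
    · rcases h.reversed u v (hδu.trans hδv.symm) (lt_trans' o huα h3) h2 with h6 | ⟨h6, _⟩
      · exact absurd huL (h6 ▸ htL)
      · exact absurd h6 hvα
  · rintro ⟨v, hv, rfl⟩
    refine ⟨hv.2.2.1, ?_⟩
    rw [le_iff_eq_or_lt']
    rcases (le_iff_eq_or_lt' o).1 (hmax v hv) with h1 | h1
    · exact Or.inl (by rw [h1])
    · refine Or.inr ((lt_or_lt o (π.injective.ne (ne_of_lt' o h1))).resolve_right fun h2 => ?_)
      rcases h.reversed v u (hv.2.2.2.trans hδu.symm) h1 h2 with h3 | ⟨h3, _⟩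
      · exact htL (h3 ▸ hv.1)
      · exact ne_of_lt' o huα h3

theorem LeftInv.moveRight_lt_iff (h : LeftInv o δ π L t α) (htL : t ∉ L) (hδt : δ t = 1)
    (hαt : α ≠ t) {u : T} (hu : u ∈ leftOf o δ π L α)
    (hmax : ∀ v ∈ leftOf o δ π L α, o.le v u) (x y : T) :
    (moveRight o (π α) (π u)).lt x y ↔ (o.lt x y ∧ ¬ (x = π α ∧ y ∈ π '' leftOf o δ π L α)) ∨
      (y = π α ∧ x ∈ π '' leftOf o δ π L α) := by
  rw [moveRight_lt o hu.2.2.1, ← h.between_iff htL hδt hαt hu hmax,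
    ← h.between_iff htL hδt hαt hu hmax]
  refine or_congr (and_congr_right fun h1 => not_congr (and_congr_right fun h2 => ?_)) Iff.rfl
  rw [← h2]
  exact (and_iff_right h1).symm

/-- The move removes the reversals at `α` and changes only comparisons of `π α` with the elements it
passes. New reversals thus end at `π α` and start at images of elements of `L`, which lie in `L` or
equal `t`. -/
theorem LeftInv.step (h : LeftInv o δ π L t α) (htL : t ∉ L) (hδt : δ t = 1)
    (hαt : α ≠ t) (hfix : π α ≠ α) (hL : ∀ x ∈ L, π x ∈ L ∨ π x = t) {u : T}
    (hu : u ∈ leftOf o δ π L α) (hmax : ∀ v ∈ leftOf o δ π L α, o.le v u) :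
    LeftInv (moveRight o (π α) (π u)) δ π L t (π α) := by
  have hlt := h.moveRight_lt_iff htL hδt hαt hu hmax
  refine ⟨fun x y hx hy => ?_, fun x y hxy h1 h2 => ?_, fun x hx hx1 h1 => ?_⟩
  · rw [hlt]
    refine Or.inl ⟨h.zero_one x y hx hy, ?_⟩
    rintro ⟨h1, v, hv, h2⟩
    rw [← π.injective h1, π.injective h2] at hv
    have := hv.2.2.2
    rw [hx, hy] at this
    exact absurd this (by decide)
  · rw [hlt] at h1 h2
    rcases h1 with ⟨h1, h1'⟩ | ⟨h1, v, hv, h1'⟩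
    · rcases h2 with ⟨h2, h2'⟩ | ⟨h2, v, hv, h2'⟩
      · rcases h.reversed x y hxy h1 h2 with h3 | ⟨rfl, h3⟩
        · exact Or.inl h3
        · exact absurd ⟨rfl, x, ⟨h3, h1, h2, hxy⟩, rfl⟩ h2'
      · rw [π.injective h2', ← π.injective h2] at hv
        exact absurd h1 (not_lt_of_lt o hv.2.1)
    · rcases hL v hv.1 with h3 | h3
      · exact Or.inr ⟨h1, h1' ▸ h3⟩
      · exact Or.inl (h1' ▸ h3)
  · rw [hlt] at h1 ⊢
    rcases h1 with ⟨h1, h1'⟩ | ⟨rfl, v, hv, h1'⟩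
    · refine Or.inl ⟨h.ones x hx hx1 h1, ?_⟩
      rintro ⟨_, v, hv, h2⟩
      exact htL (π.injective h2 ▸ hv.1)
    · have hne : π α ≠ t := fun e => htL (e ▸ hx)
      refine Or.inl ⟨(lt_or_lt o (π.injective.ne hne)).resolve_right fun h2 => ?_, ?_⟩
      · rcases h.reversed (π α) t (hx1.trans hδt.symm) (h1' ▸ hv.2.2.1) h2 with h3 | ⟨h3, _⟩
        · exact hne h3
        · exact hαt h3.symm
      · rintro ⟨h2, _⟩
        exact hfix (π.injective h2)

/-- Before the move no element of `L` left of `π α` was reversed with it, so the new set comes from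
the elements passed. `hexcl` ensures that `α` itself, if passed, was not already reversed with `π
α`. -/
theorem LeftInv.leftOf_step (h : LeftInv o δ π L t α) (htL : t ∉ L) (hδt : δ t = 1)
    (hαt : α ≠ t) (hαt' : π α ≠ t) (hfix : π α ≠ α) {u : T}
    (hu : u ∈ leftOf o δ π L α) (hmax : ∀ v ∈ leftOf o δ π L α, o.le v u)
    (hexcl : π α ∉ leftOf o δ π L α) :
    leftOf (moveRight o (π α) (π u)) δ π L (π α) =
      {x | x ∈ L ∧ x ∈ π '' leftOf o δ π L α ∧ δ x = δ (π α)} := by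
  have hlt := h.moveRight_lt_iff htL hδt hαt hu hmax
  ext x
  constructor
  · rintro ⟨hx, h1, h2, hδ⟩
    refine ⟨hx, ?_, hδ⟩
    rw [hlt] at h1 h2
    rcases h1 with ⟨h1, -⟩ | ⟨-, h1⟩
    · exfalso
      rcases h2 with ⟨h2, -⟩ | ⟨h2, v, hv, h2'⟩
      · rcases h.reversed x (π α) hδ h1 h2 with h3 | ⟨h3, _⟩
        · exact htL (h3 ▸ hx)
        · exact hfix h3
      · rw [π.injective h2'] at hv
        rw [π.injective h2] at h1
        exact not_lt_of_lt o h1 hv.2.1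
    · exact h1
  · rintro ⟨hx, hxi, hδ⟩
    refine ⟨hx, (hlt _ _).2 (Or.inr ⟨rfl, hxi⟩), (hlt _ _).2 (Or.inl ⟨?_, ?_⟩), hδ⟩
    · have h1 : o.lt (π α) x := by
        obtain ⟨v, hv, rfl⟩ := hxi
        exact hv.2.2.1
      refine (lt_or_lt o (π.injective.ne (ne_of_lt' o h1))).resolve_right fun h2 => ?_
      rcases h.reversed (π α) x hδ.symm h1 h2 with h3 | ⟨rfl, h3⟩
      · exact hαt' h3
      · exact hexcl ⟨h3, h1, h2, hδ.symm⟩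
    · rintro ⟨h1, _⟩
      exact hfix (π.injective h1)

/-- The reversals at `t` are left to the second process. They could change only if `π α` passed `t`
or `π t`; passing `t` is a hit. -/
theorem LeftInv.reversed_step (h : LeftInv o δ π L t α) (htL : t ∉ L) (hδt : δ t = 1)
    (hαt : α ≠ t) (hαt' : π α ≠ t) {u : T}
    (hu : u ∈ leftOf o δ π L α) (hmax : ∀ v ∈ leftOf o δ π L α, o.le v u)
    (hhit : π.symm t ∉ leftOf o δ π L α) :
    rightOf (moveRight o (π α) (π u)) δ π t = rightOf o δ π t := by
  have hlt := h.moveRight_lt_iff htL hδt hαt hu hmax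
  have h1 : t ∉ π '' leftOf o δ π L α := by
    rintro ⟨v, hv, hv'⟩
    rw [← hv', Equiv.symm_apply_apply] at hhit
    exact hhit hv
  have h2 : π t ∉ π '' leftOf o δ π L α := by
    rintro ⟨v, hv, hv'⟩
    exact htL (π.injective hv' ▸ hv.1)
  have h3 : π t ≠ π α := fun e => hαt (π.injective e).symm
  ext y
  simp only [rightOf, Set.mem_ofPred_eq, hlt, h1, h2, h3, hαt'.symm, and_false, false_and,
    not_false_eq_true, and_true, or_false]

/-- Mirror image of `LeftInv.between_iff`; as all reversals start at `β`, a preimage on the wrong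
side contradicts the invariant at once. -/
theorem RightInv.between_iff (h : RightInv o δ π β) {u : T} (hu : u ∈ rightOf o δ π β)
    (hmin : ∀ v ∈ rightOf o δ π β, o.le u v) (w : T) :
    (o.le (π u) w ∧ o.lt w (π β)) ↔ w ∈ π '' rightOf o δ π β := by
  obtain ⟨huβ, hπu, hδu⟩ := hu
  constructor
  · obtain ⟨v, rfl⟩ := π.surjective w
    rintro ⟨h2, h1⟩
    refine ⟨v, ?_, rfl⟩
    rw [le_iff_eq_or_lt'] at h2
    rcases h2 with h2 | h2
    · rw [← π.injective h2]; exact ⟨huβ, hπu, hδu⟩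
    have hδv : δ v = δ β := by
      rcases label_cases (δ v) with hv | hv <;> rcases label_cases (δ β) with ha | ha
      · rw [hv, ha]
      · exact absurd h2 (not_lt_of_lt o (h.zero_one v u hv (hδu.trans ha)))
      · exact absurd h1 (not_lt_of_lt o (h.zero_one β v ha hv))
      · rw [hv, ha]
    have hvβ : v ≠ β := fun e => ne_of_lt' o h1 (by rw [e])
    rcases lt_or_lt o hvβ with h3 | h3
    · exact absurd (h.reversed v u (hδv.trans hδu.symm) (lt_trans' o h3 huβ) h2) hvβ
    · exact ⟨h3, h1, hδv⟩
  · rintro ⟨v, hv, rfl⟩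
    refine ⟨?_, hv.2.1⟩
    rw [le_iff_eq_or_lt']
    rcases (le_iff_eq_or_lt' o).1 (hmin v hv) with h1 | h1
    · exact Or.inl (by rw [h1])
    · refine Or.inr ((lt_or_lt o (π.injective.ne (ne_of_lt' o h1))).resolve_right fun h2 => ?_)
      exact ne_of_lt' o huβ (h.reversed u v (hδu.trans hv.2.2.symm) h1 h2).symm

theorem RightInv.moveLeft_lt_iff (h : RightInv o δ π β) {u : T} (hu : u ∈ rightOf o δ π β)
    (hmin : ∀ v ∈ rightOf o δ π β, o.le u v) (x y : T) :
    (moveLeft o (π β) (π u)).lt x y ↔ (o.lt x y ∧ ¬ (y = π β ∧ x ∈ π '' rightOf o δ π β)) ∨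
      (x = π β ∧ y ∈ π '' rightOf o δ π β) := by
  rw [moveLeft_lt o hu.2.1, ← h.between_iff hu hmin, ← h.between_iff hu hmin]
  refine or_congr (and_congr_right fun h1 => not_congr (and_congr_right fun h2 => ?_)) Iff.rfl
  rw [← h2]
  exact (and_iff_left h1).symm

theorem RightInv.step (h : RightInv o δ π β) {u : T} (hu : u ∈ rightOf o δ π β)
    (hmin : ∀ v ∈ rightOf o δ π β, o.le u v) :
    RightInv (moveLeft o (π β) (π u)) δ π (π β) := by
  have hlt := h.moveLeft_lt_iff hu hmin
  refine ⟨fun x y hx hy => ?_, fun x y hxy h1 h2 => ?_⟩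
  · rw [hlt]
    refine Or.inl ⟨h.zero_one x y hx hy, ?_⟩
    rintro ⟨h1, v, hv, h2⟩
    rw [← π.injective h1, π.injective h2] at hv
    have := hv.2.2
    rw [hx, hy] at this
    exact absurd this (by decide)
  · rw [hlt] at h1 h2
    rcases h1 with ⟨h1, h1'⟩ | ⟨h1, -⟩
    · rcases h2 with ⟨h2, h2'⟩ | ⟨h2, v, hv, h2'⟩
      · have h3 := h.reversed x y hxy h1 h2
        subst h3
        exact absurd ⟨rfl, y, ⟨h1, h2, hxy.symm⟩, rfl⟩ h2'
      · rw [π.injective h2', ← π.injective h2] at hv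
        exact absurd h1 (not_lt_of_lt o hv.1)
    · exact h1

theorem RightInv.rightOf_step_subset (h : RightInv o δ π β) (hfix : π β ≠ β) {u : T}
    (hu : u ∈ rightOf o δ π β) (hmin : ∀ v ∈ rightOf o δ π β, o.le u v) :
    rightOf (moveLeft o (π β) (π u)) δ π (π β) ⊆
      {x | x ∈ π '' rightOf o δ π β ∧ δ x = δ (π β)} := by
  have hlt := h.moveLeft_lt_iff hu hmin
  rintro x ⟨h1, h2, hδ⟩
  refine ⟨?_, hδ⟩
  rw [hlt] at h1 h2
  rcases h1 with ⟨h1, -⟩ | ⟨-, h1⟩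
  · exfalso
    rcases h2 with ⟨h2, -⟩ | ⟨h2, v, hv, h2'⟩
    · exact hfix (h.reversed (π β) x hδ.symm h1 h2)
    · rw [π.injective h2'] at hv
      rw [π.injective h2] at h1
      exact not_lt_of_lt o h1 hv.1
  · exact h1

theorem RightInv.subset_rightOf_step (h : RightInv o δ π β) (hfix : π β ≠ β) {u : T}
    (hu : u ∈ rightOf o δ π β) (hmin : ∀ v ∈ rightOf o δ π β, o.le u v)
    (hexcl : π β ∉ rightOf o δ π β) :
    {x | x ∈ π '' rightOf o δ π β ∧ δ x = δ (π β)} ⊆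
      rightOf (moveLeft o (π β) (π u)) δ π (π β) := by
  have hlt := h.moveLeft_lt_iff hu hmin
  rintro x ⟨hxi, hδ⟩
  refine ⟨(hlt _ _).2 (Or.inr ⟨rfl, hxi⟩), (hlt _ _).2 (Or.inl ⟨?_, ?_⟩), hδ⟩
  · have h1 : o.lt x (π β) := by
      obtain ⟨v, hv, rfl⟩ := hxi
      exact hv.2.1
    refine (lt_or_lt o (π.injective.ne (ne_of_lt' o h1))).resolve_right fun h2 => ?_
    have h3 := h.reversed x (π β) hδ h1 h2
    subst h3
    exact hexcl ⟨h1, h2, hδ.symm⟩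
  · rintro ⟨h1, _⟩
    exact hfix (π.injective h1)

end Step

end ABS
end

noncomputable section
namespace ABS

/-! ### The two processes -/

section Steps

theorem aSetOf_eq_leftOf {X Y : Type*} (o : LinearOrder (X ⊕ Y)) (δ : X ⊕ Y → Fin 2)
    (π : Equiv.Perm (X ⊕ Y)) (s : X ⊕ Y) (n : ℕ) :
    aSetOf o δ π s n = leftOf o δ π {x | x.isLeft} ((π ^ n) s) := by
  rw [aSetOf, pow_succ']
  rfl

theorem bSetOf_eq_rightOf {T : Type*} (o : LinearOrder T) (δ : T → Fin 2)
    (π : Equiv.Perm T) (s : T) (n : ℕ) :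
    bSetOf o δ π s n = rightOf o δ π ((π ^ n) s) := by
  rw [bSetOf, pow_succ']
  rfl

variable {X Y : Type*} [DecidableEq X] [DecidableEq Y]

/-- The elements `πⁿ(u)`, for `u` of label `0` between `s` and `t`, such that the orbits of `u` and
`s` have equal labels up to `n`, and that of `u` stays in the first summand. -/
def leftSet (S : ABS (X ⊕ Y)) (s t : X ⊕ Y) (n : ℕ) : Set (X ⊕ Y) :=
  {x | ∃ u, S.δ u = 0 ∧ S.ord.lt s u ∧ S.ord.lt u t ∧
    (∀ k ≤ n, ((smallMod S.π s t ^ k) u).isLeft ∧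
      S.δ ((smallMod S.π s t ^ k) u) = S.δ ((smallMod S.π s t ^ k) s)) ∧
    (smallMod S.π s t ^ n) u = x}

/-- The elements `πⁿ(w)`, for `w` of label `1` between `s` and `t`, such that the orbits of `w` and
`t` have equal labels up to `n`. -/
def rightSet (S : ABS (X ⊕ Y)) (s t : X ⊕ Y) (n : ℕ) : Set (X ⊕ Y) :=
  {x | ∃ w, S.δ w = 1 ∧ S.ord.lt s w ∧ S.ord.lt w t ∧
    (∀ k ≤ n, S.δ ((smallMod S.π s t ^ k) w) = S.δ ((smallMod S.π s t ^ k) t)) ∧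
    (smallMod S.π s t ^ n) w = x}

/-- The properties of a sequence on `X ⊕ Y` and two of its elements which determine the
processes. -/
structure IsSplit (S : ABS (X ⊕ Y)) (s t : X ⊕ Y) (h₁ : ℕ) : Prop where
  compat : S.IsCompatible
  lt : S.ord.lt s t
  label_left : S.δ s = 0
  label_right : S.δ t = 1
  right : ¬ t.isLeft
  zeros : ∀ x, S.δ x = 0 → S.ord.lt s x → S.ord.lt x t → x.isLeft
  ones : ∀ x : X ⊕ Y, x.isLeft → S.δ x = 1 → S.ord.lt x s
  map_left : ∀ x : X ⊕ Y, x.isLeft → (smallMod S.π s t x).isLeft ∨ smallMod S.π s t x = t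
  map_ne : ∀ x, smallMod S.π s t x ≠ x
  orbit : ∀ n < h₁, ((smallMod S.π s t ^ n) s).isLeft
  notMem_leftSet : ∀ n, (smallMod S.π s t ^ (n + 1)) s ∉ leftSet S s t n
  notMem_rightSet : ∀ n, (smallMod S.π s t ^ (n + 1)) t ∉ rightSet S s t n

variable {S : ABS (X ⊕ Y)} {s t : X ⊕ Y} {h₁ : ℕ}

theorem leftSet_succ (n : ℕ) : leftSet S s t (n + 1) =
    {x | x ∈ {x : X ⊕ Y | x.isLeft} ∧ x ∈ smallMod S.π s t '' leftSet S s t n ∧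
      S.δ x = S.δ ((smallMod S.π s t ^ (n + 1)) s)} := by
  ext x
  constructor
  · rintro ⟨u, hu, h1, h2, h3, rfl⟩
    refine ⟨(h3 _ le_rfl).1, ⟨_, ⟨u, hu, h1, h2, fun k hk => h3 k (by omega), rfl⟩, ?_⟩,
      (h3 _ le_rfl).2⟩
    rw [pow_succ', Equiv.Perm.mul_apply]
  · rintro ⟨hx, ⟨_, ⟨u, hu, h1, h2, h3, rfl⟩, rfl⟩, hδ⟩
    rw [← Equiv.Perm.mul_apply, ← pow_succ'] at hδ hx ⊢
    refine ⟨u, hu, h1, h2, fun k hk => ?_, rfl⟩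
    rcases Nat.le_succ_iff.1 hk with hk | rfl
    · exact h3 k hk
    · exact ⟨hx, hδ⟩

theorem rightSet_succ (n : ℕ) : rightSet S s t (n + 1) =
    {x | x ∈ smallMod S.π s t '' rightSet S s t n ∧
      S.δ x = S.δ ((smallMod S.π s t ^ (n + 1)) t)} := by
  ext x
  constructor
  · rintro ⟨u, hu, h1, h2, h3, rfl⟩
    refine ⟨⟨_, ⟨u, hu, h1, h2, fun k hk => h3 k (by omega), rfl⟩, ?_⟩, h3 _ le_rfl⟩
    rw [pow_succ', Equiv.Perm.mul_apply]
  · rintro ⟨⟨_, ⟨u, hu, h1, h2, h3, rfl⟩, rfl⟩, hδ⟩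
    rw [← Equiv.Perm.mul_apply, ← pow_succ'] at hδ ⊢
    refine ⟨u, hu, h1, h2, fun k hk => ?_, rfl⟩
    rcases Nat.le_succ_iff.1 hk with hk | rfl
    · exact h3 k hk
    · exact hδ

/-- The starting order and `π` both interchange `s` and `t`; the two interchanges cancel. -/
theorem swapOrder_smallMod_lt (h : S.IsCompatible) (x y : X ⊕ Y) :
    (swapOrder S.ord s t).lt (smallMod S.π s t x) (smallMod S.π s t y) ↔
      S.δ x < S.δ y ∨ (S.δ x = S.δ y ∧ S.ord.lt x y) := by
  rw [← h]
  change S.ord.lt (Equiv.swap s t (Equiv.swap s t (S.π x)))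
    (Equiv.swap s t (Equiv.swap s t (S.π y))) ↔ _
  rw [Equiv.swap_apply_self, Equiv.swap_apply_self]

/-- The equally labelled pairs whose order is reversed by `π` in the starting order. -/
theorem reversed_swapOrder_iff (h : IsSplit S s t h₁) {x y : X ⊕ Y} (hδ : S.δ x = S.δ y) :
    ((swapOrder S.ord s t).lt x y ∧
      (swapOrder S.ord s t).lt (smallMod S.π s t y) (smallMod S.π s t x)) ↔
      (x = t ∧ S.ord.lt s y ∧ S.ord.lt y t) ∨ (y = s ∧ S.ord.lt s x ∧ S.ord.lt x t) := by
  rw [swapOrder_smallMod_lt h.compat]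
  have h1 := mem_disagree_zero S h.compat h.lt x y
  rw [disagree, Set.mem_ofPred_eq, zero_add, refineLt_one_smallMod S h.compat, refineLt] at h1
  have h2 : (S.δ y < S.δ x ∨ (S.δ y = S.δ x ∧ S.ord.lt y x)) ↔ S.ord.lt y x := by simp [hδ]
  have h3 : ¬ (x = t ∧ y = s) := by
    rintro ⟨rfl, rfl⟩
    rw [h.label_left, h.label_right] at hδ
    cases hδ
  rw [h2]
  simp only [h3, false_or] at h1
  exact h1

variable [Finite X] [Finite Y]

theorem aStep_succ (n : ℕ) (h : (aSet S s t n).Nonempty) :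
    ∃ u ∈ aSet S s t n, (∀ v ∈ aSet S s t n, (aStep S s t n).1.le v u) ∧
      (aStep S s t (n + 1)).1 = moveRight (aStep S s t n).1 ((smallMod S.π s t ^ (n + 1)) s)
        (smallMod S.π s t u) ∧
      aSet S s t (n + 1) = aSetOf (aStep S s t (n + 1)).1 S.δ (smallMod S.π s t) s (n + 1) := by
  have h' : (aStep S s t n).2.Nonempty := h
  have hm := (exists_max (aStep S s t n).1 (aStep S s t n).2 h').choose_spec
  refine ⟨maxElt (aStep S s t n).1 (aStep S s t n).2 h', hm.1, hm.2, ?_, ?_⟩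
  · rw [aStep, dif_pos h']
  · rw [aSet, aStep, dif_pos h']

theorem bStep_succ (n : ℕ) (h : (bSet S s t n).Nonempty) :
    ∃ u ∈ bSet S s t n, (∀ v ∈ bSet S s t n, (bStep S s t n).1.le u v) ∧
      (bStep S s t (n + 1)).1 = moveLeft (bStep S s t n).1 ((smallMod S.π s t ^ (n + 1)) t)
        (smallMod S.π s t u) ∧
      bSet S s t (n + 1) = bSetOf (bStep S s t (n + 1)).1 S.δ (smallMod S.π s t) t (n + 1) := by
  have h' : (bStep S s t n).2.Nonempty := h
  have hm := (exists_min (bStep S s t n).1 (bStep S s t n).2 h').choose_spec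
  refine ⟨minElt (bStep S s t n).1 (bStep S s t n).2 h', hm.1, hm.2, ?_, ?_⟩
  · rw [bStep, dif_pos h']
  · rw [bSet, bStep, dif_pos h']

theorem aSet_succ_of_empty (n : ℕ) (h : aSet S s t n = ∅) : aSet S s t (n + 1) = ∅ := by
  have h' : ¬ (aStep S s t n).2.Nonempty := Set.not_nonempty_iff_eq_empty.2 h
  rw [aSet, aStep, dif_neg h']

theorem bSet_succ_of_empty (n : ℕ) (h : bSet S s t n = ∅) : bSet S s t (n + 1) = ∅ := by
  have h' : ¬ (bStep S s t n).2.Nonempty := Set.not_nonempty_iff_eq_empty.2 h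
  rw [bSet, bStep, dif_neg h']

theorem aSet_eq_empty_of_le {k l : ℕ} (hk : aSet S s t k = ∅) (hl : k ≤ l) :
    aSet S s t l = ∅ := by
  induction l, hl using Nat.le_induction with
  | base => exact hk
  | succ l _ ih => exact aSet_succ_of_empty l ih

theorem bSet_eq_empty_of_le {k l : ℕ} (hk : bSet S s t k = ∅) (hl : k ≤ l) :
    bSet S s t l = ∅ := by
  induction l, hl using Nat.le_induction with
  | base => exact hk
  | succ l _ ih => exact bSet_succ_of_empty l ih

/-- The clauses need each other: the invariant drives the step, and the description by `leftSet`
provides the exclusion that `LeftInv.leftOf_step` asks for. The last clause keeps the start of the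
second process intact while there is no hit. -/
theorem aStep_spec (h : IsSplit S s t h₁) (n : ℕ) (hn : n < h₁)
    (hne : ∀ k < n, (aSet S s t k).Nonempty) :
    LeftInv (aStep S s t n).1 S.δ (smallMod S.π s t) {x | x.isLeft} t
      ((smallMod S.π s t ^ n) s) ∧
    aSet S s t n = leftOf (aStep S s t n).1 S.δ (smallMod S.π s t) {x | x.isLeft}
      ((smallMod S.π s t ^ n) s) ∧
    aSet S s t n = leftSet S s t n ∧
    ((∀ k < n, (smallMod S.π s t).symm t ∉ aSet S s t k) →
      rightOf (aStep S s t n).1 S.δ (smallMod S.π s t) t = rightSet S s t 0) := by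
  have hlab : ∀ {x}, x = s → S.δ x = 0 := by rintro _ rfl; exact h.label_left
  induction n with
  | zero =>
    have hset : aSet S s t 0 = leftOf (aStep S s t 0).1 S.δ (smallMod S.π s t) {x | x.isLeft}
      ((smallMod S.π s t ^ 0) s) := by rw [← aSetOf_eq_leftOf]; rfl
    refine ⟨⟨fun x y hx hy => ?_, fun x y hxy h1 h2 => ?_, fun x hx hx1 h1 => ?_⟩, hset, ?_, ?_⟩
    · refine (swapOrder_smallMod_lt h.compat x y).2 (Or.inl ?_)
      rw [hx, hy]; decide
    · rcases (reversed_swapOrder_iff h hxy).1 ⟨h1, h2⟩ with h3 | ⟨rfl, h3, h4⟩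
      · exact Or.inl h3.1
      · exact Or.inr ⟨rfl, h.zeros x (hxy.trans h.label_left) h3 h4⟩
    · exfalso
      change S.ord.lt (Equiv.swap s t t) (Equiv.swap s t x) at h1
      have hxs : x ≠ s := fun e => by rw [hlab e] at hx1; cases hx1
      have hxt : x ≠ t := fun e => h.right (e ▸ hx)
      rw [Equiv.swap_apply_right, Equiv.swap_apply_of_ne_of_ne hxs hxt] at h1
      exact not_lt_of_lt _ h1 (h.ones x hx hx1)
    · rw [hset]
      ext x
      constructor
      · rintro ⟨hx, h1, h2, h3⟩
        simp only [pow_zero, Equiv.Perm.one_apply] at h1 h2 h3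
        rcases (reversed_swapOrder_iff h h3).1 ⟨h1, h2⟩ with h4 | h4
        · exact absurd (h4.1 ▸ hx) h.right
        · refine ⟨x, h3.trans h.label_left, h4.2.1, h4.2.2, fun k hk => ?_, rfl⟩
          obtain rfl := Nat.le_zero.1 hk
          exact ⟨hx, h3⟩
      · rintro ⟨u, hu, h1, h2, h3, rfl⟩
        have h4 := h3 0 le_rfl
        simp only [pow_zero, Equiv.Perm.one_apply] at h4 ⊢
        have h5 := (reversed_swapOrder_iff h h4.2).2 (Or.inr ⟨rfl, h1, h2⟩)
        exact ⟨h4.1, h5.1, h5.2, h4.2⟩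
    · intro _
      ext y
      constructor
      · rintro ⟨h1, h2, h3⟩
        rcases (reversed_swapOrder_iff h h3.symm).1 ⟨h1, h2⟩ with ⟨_, h4⟩ | ⟨h4, h5⟩
        · refine ⟨y, h3.trans h.label_right, h4.1, h4.2, fun k hk => ?_, rfl⟩
          obtain rfl := Nat.le_zero.1 hk
          exact h3
        · rw [hlab h4, h.label_right] at h3
          cases h3
      · rintro ⟨w, hw, h1, h2, h3, rfl⟩
        have h4 : S.δ w = S.δ t := h3 0 le_rfl
        have h5 := (reversed_swapOrder_iff h h4.symm).2 (Or.inl ⟨rfl, h1, h2⟩)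
        exact ⟨h5.1, h5.2, h4⟩
  | succ n ih =>
    obtain ⟨i1, i2, i3, i4⟩ := ih (by omega) fun k hk => hne k (by omega)
    obtain ⟨u, hu, hmax, e1, e2⟩ := aStep_succ n (hne n (by omega))
    rw [aSetOf_eq_leftOf] at e2
    have hpow : (smallMod S.π s t ^ (n + 1)) s =
        smallMod S.π s t ((smallMod S.π s t ^ n) s) := by
      rw [pow_succ', Equiv.Perm.mul_apply]
    have hαt : (smallMod S.π s t ^ n) s ≠ t := fun e => h.right (e ▸ h.orbit n (by omega))
    have hαt' : smallMod S.π s t ((smallMod S.π s t ^ n) s) ≠ t := fun e =>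
      h.right (e ▸ hpow ▸ h.orbit (n + 1) (by omega))
    rw [i2] at hu hmax
    refine ⟨?_, e2, ?_, fun hhit => ?_⟩
    · rw [e1, hpow]
      exact i1.step h.right h.label_right hαt (h.map_ne _) h.map_left hu hmax
    · have hexcl : smallMod S.π s t ((smallMod S.π s t ^ n) s) ∉ aSet S s t n := by
        rw [i3, ← hpow]
        exact h.notMem_leftSet n
      rw [i2] at hexcl
      rw [e2, e1, hpow, i1.leftOf_step h.right h.label_right hαt hαt' (h.map_ne _) hu hmax hexcl,
        ← i2, i3, leftSet_succ, hpow]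
    · rw [e1, hpow, i1.reversed_step h.right h.label_right hαt hαt' hu hmax]
      · exact i4 fun k hk => hhit k (by omega)
      · rw [← i2]; exact hhit n (by omega)

theorem aSet_eq_leftSet (h : IsSplit S s t h₁) (n : ℕ) (hn : n < h₁) :
    aSet S s t n = leftSet S s t n := by
  induction n with
  | zero => exact (aStep_spec h 0 hn fun k hk => absurd hk (by omega)).2.2.1
  | succ n ih =>
    by_cases hne : ∀ k < n + 1, (aSet S s t k).Nonempty
    · exact (aStep_spec h (n + 1) hn hne).2.2.1
    · push Not at hne
      obtain ⟨k, hk, hk'⟩ := hne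
      have h0 := aSet_eq_empty_of_le hk' (by omega : k ≤ n)
      rw [aSet_succ_of_empty n h0, leftSet_succ, ← ih (by omega), h0]
      simp

/-- When the first process has stopped without meeting the preimage of `t`, the second process
starts with the elements of label `1` between `s` and `t`. -/
theorem bStep_zero_spec (h : IsSplit S s t h₁) {n : ℕ} (hn : n < h₁)
    (hempty : aSet S s t n = ∅) (hhit : ∀ k, (smallMod S.π s t).symm t ∉ aSet S s t k) :
    RightInv (bStep S s t 0).1 S.δ (smallMod S.π s t) t ∧ bSet S s t 0 = rightSet S s t 0 := by
  have ha : aSet S s t (aStop S s t) = ∅ := Nat.sInf_mem (s := {n | aSet S s t n = ∅}) ⟨n, hempty⟩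
  have hle : aStop S s t ≤ n := Nat.sInf_le hempty
  have hmin : ∀ k < aStop S s t, (aSet S s t k).Nonempty := fun k hk =>
    Set.nonempty_iff_ne_empty.2 (Nat.notMem_of_lt_sInf (s := {n | aSet S s t n = ∅}) hk)
  obtain ⟨i1, i2, -, i4⟩ := aStep_spec h (aStop S s t) (by omega) hmin
  refine ⟨⟨i1.zero_one, fun x y hxy h1 h2 => ?_⟩, ?_⟩
  · rcases i1.reversed x y hxy h1 h2 with h3 | ⟨rfl, h3⟩
    · exact h3
    · have : x ∈ aSet S s t (aStop S s t) := i2 ▸ ⟨h3, h1, h2, hxy⟩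
      rw [ha] at this
      exact absurd this (Set.notMem_empty _)
  · rw [← i4 fun k _ => hhit k]
    exact bSetOf_eq_rightOf _ _ _ _ 0

theorem bStep_spec (h : IsSplit S s t h₁) {m : ℕ} (hm : m < h₁)
    (hempty : aSet S s t m = ∅) (hhit : ∀ k, (smallMod S.π s t).symm t ∉ aSet S s t k) (n : ℕ)
    (hne : ∀ k < n, (bSet S s t k).Nonempty) :
    RightInv (bStep S s t n).1 S.δ (smallMod S.π s t) ((smallMod S.π s t ^ n) t) ∧
    bSet S s t n = rightOf (bStep S s t n).1 S.δ (smallMod S.π s t)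
      ((smallMod S.π s t ^ n) t) ∧
    bSet S s t n = rightSet S s t n := by
  induction n with
  | zero =>
    obtain ⟨i1, i2⟩ := bStep_zero_spec h hm hempty hhit
    exact ⟨i1, bSetOf_eq_rightOf _ _ _ _ 0, i2⟩
  | succ n ih =>
    obtain ⟨i1, i2, i3⟩ := ih fun k hk => hne k (by omega)
    obtain ⟨u, hu, hmin, e1, e2⟩ := bStep_succ n (hne n (by omega))
    rw [bSetOf_eq_rightOf] at e2
    have hpow : (smallMod S.π s t ^ (n + 1)) t =
        smallMod S.π s t ((smallMod S.π s t ^ n) t) := by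
      rw [pow_succ', Equiv.Perm.mul_apply]
    rw [i2] at hu hmin
    refine ⟨?_, e2, ?_⟩
    · rw [e1, hpow]
      exact i1.step hu hmin
    · have hexcl : smallMod S.π s t ((smallMod S.π s t ^ n) t) ∉ bSet S s t n := by
        rw [i3, ← hpow]
        exact h.notMem_rightSet n
      rw [i2] at hexcl
      rw [e2, e1, hpow, rightSet_succ, ← i3, i2, hpow]
      exact (i1.rightOf_step_subset (h.map_ne _) hu hmin).antisymm
        (i1.subset_rightOf_step (h.map_ne _) hu hmin hexcl)

theorem bSet_eq_rightSet (h : IsSplit S s t h₁) {m : ℕ} (hm : m < h₁)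
    (hempty : aSet S s t m = ∅) (hhit : ∀ k, (smallMod S.π s t).symm t ∉ aSet S s t k) (n : ℕ) :
    bSet S s t n = rightSet S s t n := by
  induction n with
  | zero => exact (bStep_zero_spec h hm hempty hhit).2
  | succ n ih =>
    by_cases hne : ∀ k < n + 1, (bSet S s t k).Nonempty
    · exact (bStep_spec h hm hempty hhit (n + 1) hne).2.2
    · push Not at hne
      obtain ⟨k, hk, hk'⟩ := hne
      have h0 := bSet_eq_empty_of_le hk' (by omega : k ≤ n)
      rw [bSet_succ_of_empty n h0, rightSet_succ, ← ih, h0]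
      simp

end Steps

end ABS
end

noncomputable section
namespace ABS

/-! ### Compatible sequences -/

section Compatible

variable {T X Y : Type*}

theorem binExp_map_zero (δ : T → Fin 2) (π : Equiv.Perm T) (x : T) :
    binExp δ π (π x) 0 = δ x := by
  simp [binExp]

theorem binExp_map_succ (δ : T → Fin 2) (π : Equiv.Perm T) (x : T) (l : ℕ) :
    binExp δ π (π x) (l + 1) = binExp δ π x l := by
  change δ ((π ^ (l + 1 + 1)).symm (π x)) = δ ((π ^ (l + 1)).symm x)
  rw [pow_succ']
  change δ ((π ^ (l + 1)).symm (π.symm (π x))) = _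
  rw [Equiv.symm_apply_apply]

theorem binExp_map_lt_iff (δ : T → Fin 2) (π : Equiv.Perm T) (x y : T) :
    binExp δ π (π x) < binExp δ π (π y) ↔
      δ x < δ y ∨ (δ x = δ y ∧ binExp δ π x < binExp δ π y) := by
  constructor
  · rintro ⟨r, hr, hr'⟩
    cases r with
    | zero => exact Or.inl (by rwa [binExp_map_zero, binExp_map_zero] at hr')
    | succ r =>
      refine Or.inr ⟨?_, r, fun l hl => ?_, ?_⟩
      · rw [← binExp_map_zero δ π x, ← binExp_map_zero δ π y]; exact hr 0 (by omega)
      · rw [← binExp_map_succ δ π x, ← binExp_map_succ δ π y]; exact hr (l + 1) (by omega)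
      · rwa [binExp_map_succ, binExp_map_succ] at hr'
  · rintro (h | ⟨h, r, hr, hr'⟩)
    · exact ⟨0, fun l hl => absurd hl (by omega), by rwa [binExp_map_zero, binExp_map_zero]⟩
    · refine ⟨r + 1, fun l hl => ?_, by rwa [binExp_map_succ, binExp_map_succ]⟩
      cases l with
      | zero => rwa [binExp_map_zero, binExp_map_zero]
      | succ l => rw [binExp_map_succ, binExp_map_succ]; exact hr l (by omega)

theorem binExp_map_eq_iff (δ : T → Fin 2) (π : Equiv.Perm T) (x y : T) :
    binExp δ π (π x) = binExp δ π (π y) ↔ δ x = δ y ∧ binExp δ π x = binExp δ π y := by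
  constructor
  · intro h
    refine ⟨?_, funext fun l => ?_⟩
    · rw [← binExp_map_zero δ π x, h, binExp_map_zero]
    · rw [← binExp_map_succ δ π x, h, binExp_map_succ]
  · rintro ⟨h, h'⟩
    refine funext fun l => ?_
    cases l with
    | zero => rwa [binExp_map_zero, binExp_map_zero]
    | succ l => rw [binExp_map_succ, binExp_map_succ, h']

theorem binOrder_lt (tie : LinearOrder T) (δ : T → Fin 2) (π : Equiv.Perm T) (x y : T) :
    (binOrder tie δ π).lt x y ↔
      binExp δ π x < binExp δ π y ∨ (binExp δ π x = binExp δ π y ∧ tie.lt x y) :=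
  Prod.Lex.toLex_lt_toLex

theorem isCompatible_binOrder (tie : LinearOrder T) (δ : T → Fin 2) (π : Equiv.Perm T)
    (h : ∀ x y, δ x = δ y → (tie.lt (π x) (π y) ↔ tie.lt x y)) :
    IsCompatible ⟨binOrder tie δ π, δ, π⟩ := by
  intro x y
  change (binOrder tie δ π).lt (π x) (π y) ↔ δ x < δ y ∨ (δ x = δ y ∧ (binOrder tie δ π).lt x y)
  rw [binOrder_lt, binOrder_lt, binExp_map_lt_iff, binExp_map_eq_iff, and_assoc, and_or_left,
    or_assoc]
  exact or_congr_right (or_congr_right (and_congr_right fun h1 =>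
    and_congr_right fun _ => h x y h1))

/-- A compatible sequence which is embedded in a set ordered by binary expansion keeps its
order. -/
theorem binOrder_lt_map_iff (tie : LinearOrder T) (δ : T → Fin 2) (π : Equiv.Perm T) (A : ABS X)
    (hA : A.IsCompatible) (f : X → T) (hδ : ∀ x, δ (f x) = A.δ x) (hπ : ∀ x, π (f x) = f (A.π x))
    (hf : ∀ x y, tie.lt (f x) (f y) ↔ A.ord.lt x y) (x y : X) :
    (binOrder tie δ π).lt (f x) (f y) ↔ A.ord.lt x y := by
  -- While labels agree, compatibility pulls `x < y` back to the preimages; the first differing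
  -- digit is then a label comparison and cannot oppose the order.
  have key : ∀ r x y, A.ord.lt x y →
      (∀ l < r, binExp δ π (f y) l = binExp δ π (f x) l) →
      ¬ binExp δ π (f y) r < binExp δ π (f x) r := by
    have hb : ∀ x l, binExp δ π (f (A.π x)) (l + 1) = binExp δ π (f x) l := fun x l => by
      rw [← hπ, binExp_map_succ]
    have hb0 : ∀ x, binExp δ π (f (A.π x)) 0 = A.δ x := fun x => by
      rw [← hπ, ← hδ, binExp_map_zero]
    intro r
    induction r with
    | zero =>
      intro x y hxy _
      obtain ⟨x, rfl⟩ := A.π.surjective x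
      obtain ⟨y, rfl⟩ := A.π.surjective y
      rw [hb0, hb0, not_lt]
      exact ((hA x y).1 hxy).elim le_of_lt fun h => h.1.le
    | succ r ih =>
      intro x y hxy hl
      obtain ⟨x, rfl⟩ := A.π.surjective x
      obtain ⟨y, rfl⟩ := A.π.surjective y
      have h0 := hl 0 (by omega)
      rw [hb0, hb0] at h0
      rw [hb, hb]
      rcases (hA x y).1 hxy with h1 | ⟨_, h1⟩
      · exact absurd h0 h1.ne'
      · refine ih x y h1 fun l hl' => ?_
        rw [← hb x, ← hb y]
        exact hl (l + 1) (by omega)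
  have key2 : ∀ x y, A.ord.lt x y → (binOrder tie δ π).lt (f x) (f y) := by
    intro x y hxy
    rw [binOrder_lt]
    rcases lt_trichotomy (binExp δ π (f x)) (binExp δ π (f y)) with h | h | ⟨r, hr, hr'⟩
    · exact Or.inl h
    · exact Or.inr ⟨h, (hf x y).2 hxy⟩
    · exact absurd hr' (key r x y hxy hr)
  refine ⟨fun h => ?_, key2 x y⟩
  by_cases hxy : x = y
  · subst hxy
    exact absurd rfl (ne_of_lt' (binOrder tie δ π) h)
  · exact (lt_or_lt A.ord hxy).resolve_right fun h' => not_lt_of_lt (binOrder tie δ π) h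
      (key2 y x h')

theorem directSum_inl_lt_iff (A : ABS X) (B : ABS Y) (hA : A.IsCompatible) (x y : X) :
    (directSum A B).ord.lt (Sum.inl x) (Sum.inl y) ↔ A.ord.lt x y :=
  binOrder_lt_map_iff (sumOrder A.ord B.ord) _ _ A hA Sum.inl (fun _ => rfl) (fun _ => rfl)
    (fun x y => by
      let _ := A.ord
      let _ := B.ord
      exact Sum.Lex.inl_lt_inl_iff) x y

theorem directSum_inr_lt_iff (A : ABS X) (B : ABS Y) (hB : B.IsCompatible) (x y : Y) :
    (directSum A B).ord.lt (Sum.inr x) (Sum.inr y) ↔ B.ord.lt x y :=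
  binOrder_lt_map_iff (sumOrder A.ord B.ord) _ _ B hB Sum.inr (fun _ => rfl) (fun _ => rfl)
    (fun x y => by
      let _ := A.ord
      let _ := B.ord
      exact Sum.Lex.inr_lt_inr_iff) x y

theorem IsCompatible.lt_iff {A : ABS X} (hA : A.IsCompatible) {x y : X} (h : A.δ x = A.δ y) :
    A.ord.lt (A.π x) (A.π y) ↔ A.ord.lt x y := by
  rw [hA x y, h]
  simp

theorem isCompatible_directSum (A : ABS X) (B : ABS Y) (hA : A.IsCompatible)
    (hB : B.IsCompatible) : (directSum A B).IsCompatible := by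
  refine isCompatible_binOrder _ _ _ ?_
  let _ := A.ord
  let _ := B.ord
  rintro (x | x) (y | y) h
  · change toLex (Sum.inl (A.π x) : X ⊕ Y) < toLex (Sum.inl (A.π y)) ↔
      toLex (Sum.inl x : X ⊕ Y) < toLex (Sum.inl y)
    rw [Sum.Lex.inl_lt_inl_iff, Sum.Lex.inl_lt_inl_iff]
    exact hA.lt_iff h
  · exact iff_of_true (Sum.Lex.inl_lt_inr _ _) (Sum.Lex.inl_lt_inr _ _)
  · exact iff_of_false Sum.Lex.not_inr_lt_inl Sum.Lex.not_inr_lt_inl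
  · change toLex (Sum.inr (B.π x) : X ⊕ Y) < toLex (Sum.inr (B.π y)) ↔
      toLex (Sum.inr x : X ⊕ Y) < toLex (Sum.inr y)
    rw [Sum.Lex.inr_lt_inr_iff, Sum.Lex.inr_lt_inr_iff]
    exact hB.lt_iff h

/-- The elements up to `π t` are the images of those with smaller label, or with the label of `t`
and not beyond `t`; counting them gives the rank. -/
theorem IsCompatible.isAdmissible [Finite T] {S : ABS T} (hS : S.IsCompatible) :
    S.IsAdmissible := by
  have hle : ∀ x y, S.ord.le (S.π x) (S.π y) ↔
      S.δ x < S.δ y ∨ (S.δ x = S.δ y ∧ S.ord.le x y) := by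
    intro x y
    rw [le_iff_eq_or_lt', le_iff_eq_or_lt', hS, S.π.injective.eq_iff]
    constructor
    · rintro (rfl | h | h)
      · exact Or.inr ⟨rfl, Or.inl rfl⟩
      · exact Or.inl h
      · exact Or.inr ⟨h.1, Or.inr h.2⟩
    · rintro (h | ⟨h, h' | h'⟩)
      · exact Or.inr (Or.inl h)
      · exact Or.inl h'
      · exact Or.inr (Or.inr ⟨h, h'⟩)
  have hr : ∀ t, S.rank (S.π t) =
      {u | S.δ u < S.δ t ∨ (S.δ u = S.δ t ∧ S.ord.le u t)}.ncard := by
    intro t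
    refine Eq.trans (congrArg Set.ncard ?_) (Set.ncard_image_of_injective _ S.π.injective)
    ext x
    obtain ⟨x, rfl⟩ := S.π.surjective x
    rw [S.π.injective.mem_set_image]
    exact hle x t
  refine fun t => ⟨fun h => ?_, fun h => ?_⟩
  · rw [hr, h]
    congr 1
    ext u
    simp [and_comm]
  · rw [hr, h, ← Set.ncard_union_eq]
    · congr 1
      ext u
      simp only [Set.mem_ofPred_eq, Set.mem_union]
      rw [and_comm]
      refine or_congr_left ?_
      generalize S.δ u = a
      revert a
      decide
    · rw [Set.disjoint_left]
      rintro u h1 ⟨_, h2⟩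
      rw [Set.mem_ofPred_eq, h2] at h1
      cases h1

end Compatible

/-! ### The sequence of `N_{m,n}` -/

section Simple

variable {m n : ℕ}

theorem simple_δ_eq_one_iff (a : Fin (m + n)) : (simple m n).δ a = 1 ↔ a.val < m := by
  simp only [simple]
  split_ifs with h <;> simp [h]

theorem simple_δ_eq_zero_iff (a : Fin (m + n)) : (simple m n).δ a = 0 ↔ m ≤ a.val := by
  simp only [simple]
  split_ifs with h <;> simp <;> omega

theorem simple_π_val (a : Fin (m + n)) :
    ((simple m n).π a).val = if a.val < m then a.val + n else a.val - m := by
  obtain ⟨a, ha⟩ := a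
  change (finAddFlip ⟨a, ha⟩).val = _
  split_ifs with h
  · rw [finAddFlip_apply_mk_left h]; exact add_comm _ _
  · rw [finAddFlip_apply_mk_right (by simpa using h)]

theorem simple_π_pow_val (a : Fin (m + n)) (k : ℕ) :
    (((simple m n).π ^ k) a).val = rot m n a k := by
  induction k with
  | zero => rw [rot_zero a.2]; rfl
  | succ k ih =>
    rw [pow_succ', Equiv.Perm.mul_apply, simple_π_val, ih, rot_succ a.2]

theorem simple_lt_iff (a b : Fin (m + n)) : (simple m n).ord.lt a b ↔ a.val < b.val := Iff.rfl

theorem isCompatible_simple : (simple m n).IsCompatible := by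
  intro a b
  rw [simple_lt_iff, simple_lt_iff, simple_π_val, simple_π_val]
  simp only [simple]
  have := a.2
  have := b.2
  split_ifs <;> simp <;> omega

end Simple

/-! ### Standard bases of the Dieudonné modules -/

section Associated

variable (p : ℕ) (K : Type*) [Field K] [Fact p.Prime] [CharP K p] [PerfectRing K p]

/-- The standard basis vectors of `N_{m,n}`. -/
theorem simple_F_single {m n : ℕ} (a : Fin (m + n)) :
    ((simple m n).δ a = 0 → (DM1.simple p K m n).F (Pi.single a (1 : K) : Fin (m + n) → K) =
        (Pi.single ((simple m n).π a) (1 : K) : Fin (m + n) → K) ∧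
      (DM1.simple p K m n).V (Pi.single ((simple m n).π a) (1 : K) : Fin (m + n) → K) =
        (0 : Fin (m + n) → K)) ∧
    ((simple m n).δ a = 1 → (DM1.simple p K m n).F (Pi.single a (1 : K) : Fin (m + n) → K) =
        (0 : Fin (m + n) → K) ∧
      (DM1.simple p K m n).V (Pi.single ((simple m n).π a) (1 : K) : Fin (m + n) → K) =
        (Pi.single a (1 : K) : Fin (m + n) → K)) := by
  have hF : ∀ (x : Fin (m + n) → K) (j : Fin (m + n)),
      ((DM1.simple p K m n).F x : Fin (m + n) → K) j =
        if hj : j.val < n then frobeniusEquiv K p (x ⟨j.val + m, by omega⟩) else 0 :=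
    fun _ _ => rfl
  have hV : ∀ (x : Fin (m + n) → K) (j : Fin (m + n)),
      ((DM1.simple p K m n).V x : Fin (m + n) → K) j =
        if hj : j.val < m then (frobeniusEquiv K p).symm (x ⟨j.val + n, by omega⟩) else 0 :=
    fun _ _ => rfl
  have hπ := simple_π_val a
  have ha := a.2
  rw [simple_δ_eq_zero_iff, simple_δ_eq_one_iff]
  refine ⟨fun h => ⟨funext fun j => ?_, funext fun j => ?_⟩,
    fun h => ⟨funext fun j => ?_, funext fun j => ?_⟩⟩
  · rw [if_neg (by omega)] at hπ
    rw [hF]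
    simp only [Pi.single_apply, Fin.ext_iff, hπ]
    split_ifs <;> first | omega | simp
  · rw [if_neg (by omega)] at hπ
    rw [hV]
    simp only [Pi.single_apply, Fin.ext_iff, hπ, Pi.zero_apply]
    split_ifs <;> first | omega | simp
  · rw [hF]
    simp only [Pi.single_apply, Fin.ext_iff, Pi.zero_apply]
    split_ifs <;> first | omega | simp
  · rw [if_pos h] at hπ
    rw [hV]
    simp only [Pi.single_apply, Fin.ext_iff, hπ]
    split_ifs <;> first | omega | simp

theorem isAssociated_directSum (m₁ n₁ m₂ n₂ : ℕ) :
    (directSum (simple m₁ n₁) (simple m₂ n₂)).IsAssociated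
      (DM1.prod (DM1.simple p K m₁ n₁) (DM1.simple p K m₂ n₂)) := by
  refine ⟨(isCompatible_directSum _ _ isCompatible_simple isCompatible_simple).isAdmissible, ?_⟩
  let e : Module.Basis (Fin (m₁ + n₁) ⊕ Fin (m₂ + n₂)) K
      ((Fin (m₁ + n₁) → K) × (Fin (m₂ + n₂) → K)) := (Pi.basisFun K _).prod (Pi.basisFun K _)
  have el : ∀ a, e (Sum.inl a) = (Pi.single a 1, 0) := fun a => by
    ext <;> simp [e]
  have er : ∀ a, e (Sum.inr a) = (0, Pi.single a 1) := fun a => by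
    ext <;> simp [e]
  refine ⟨e, ?_⟩
  let N := DM1.prod (DM1.simple p K m₁ n₁) (DM1.simple p K m₂ n₂)
  rintro (a | a)
  · have h := simple_F_single p K a
    exact ⟨fun h0 => ⟨(congrArg N.F (el a)).trans
        (Eq.trans (Prod.ext (y := (Pi.single ((simple m₁ n₁).π a) 1, 0)) (h.1 h0).1
            (map_zero (DM1.simple p K m₂ n₂).F)) (el _).symm),
      (congrArg N.V (el _)).trans (Prod.ext (h.1 h0).2 (map_zero (DM1.simple p K m₂ n₂).V))⟩,
      fun h1 => ⟨(congrArg N.F (el a)).trans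
          (Prod.ext (h.2 h1).1 (map_zero (DM1.simple p K m₂ n₂).F)),
      (congrArg N.V (el _)).trans
        (Eq.trans (Prod.ext (y := (Pi.single a 1, 0)) (h.2 h1).2
            (map_zero (DM1.simple p K m₂ n₂).V)) (el _).symm)⟩⟩
  · have h := simple_F_single p K a
    exact ⟨fun h0 => ⟨(congrArg N.F (er a)).trans
        (Eq.trans (Prod.ext (y := (0, Pi.single ((simple m₂ n₂).π a) 1))
          (map_zero (DM1.simple p K m₁ n₁).F) (h.1 h0).1) (er _).symm),
      (congrArg N.V (er _)).trans (Prod.ext (map_zero (DM1.simple p K m₁ n₁).V) (h.1 h0).2)⟩,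
      fun h1 => ⟨(congrArg N.F (er a)).trans
          (Prod.ext (map_zero (DM1.simple p K m₁ n₁).F) (h.2 h1).1),
      (congrArg N.V (er _)).trans
        (Eq.trans (Prod.ext (y := (0, Pi.single a 1))
          (map_zero (DM1.simple p K m₁ n₁).V) (h.2 h1).2) (er _).symm)⟩⟩

end Associated

end ABS
end

noncomputable section
namespace ABS

/-! ### Exchanging in `N_{m₁,n₁} ⊕ N_{m₂,n₂}` -/

section Orbits

variable {m₁ n₁ m₂ n₂ : ℕ} {i : Fin (m₁ + n₁)} {j : Fin (m₂ + n₂)}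

/-- The bijection of the exchange of `i` and `j`. -/
abbrev exchangePerm (i : Fin (m₁ + n₁)) (j : Fin (m₂ + n₂)) :
    Equiv.Perm (Fin (m₁ + n₁) ⊕ Fin (m₂ + n₂)) :=
  smallMod (directSum (simple m₁ n₁) (simple m₂ n₂)).π (Sum.inl i) (Sum.inr j)

theorem exchangePerm_inl (a : Fin (m₁ + n₁)) : exchangePerm i j (Sum.inl a) =
    if (simple m₁ n₁).π a = i then Sum.inr j else Sum.inl ((simple m₁ n₁).π a) := by
  change Equiv.swap (Sum.inl i) (Sum.inr j) (Sum.inl ((simple m₁ n₁).π a)) = _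
  rw [Equiv.swap_apply_def]
  simp

theorem exchangePerm_inr (b : Fin (m₂ + n₂)) : exchangePerm i j (Sum.inr b) =
    if (simple m₂ n₂).π b = j then Sum.inl i else Sum.inr ((simple m₂ n₂).π b) := by
  change Equiv.swap (Sum.inl i) (Sum.inr j) (Sum.inr ((simple m₂ n₂).π b)) = _
  rw [Equiv.swap_apply_def]
  simp

theorem exchangePerm_pow_inl {a : Fin (m₁ + n₁)} {n : ℕ}
    (h : ∀ k, 0 < k → k ≤ n → rot m₁ n₁ a k ≠ i) :
    (exchangePerm i j ^ n) (Sum.inl a) = Sum.inl (((simple m₁ n₁).π ^ n) a) := by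
  induction n with
  | zero => rfl
  | succ n ih =>
    rw [pow_succ', Equiv.Perm.mul_apply, ih fun k hk hk' => h k hk (by omega), exchangePerm_inl,
      ← Equiv.Perm.mul_apply, ← pow_succ', if_neg]
    intro e
    refine h (n + 1) (by omega) le_rfl ?_
    rw [← simple_π_pow_val, e]

theorem exchangePerm_pow_inr {b : Fin (m₂ + n₂)} {n : ℕ}
    (h : ∀ k, 0 < k → k ≤ n → rot m₂ n₂ b k ≠ j) :
    (exchangePerm i j ^ n) (Sum.inr b) = Sum.inr (((simple m₂ n₂).π ^ n) b) := by
  induction n with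
  | zero => rfl
  | succ n ih =>
    rw [pow_succ', Equiv.Perm.mul_apply, ih fun k hk hk' => h k hk (by omega), exchangePerm_inr,
      ← Equiv.Perm.mul_apply, ← pow_succ', if_neg]
    intro e
    refine h (n + 1) (by omega) le_rfl ?_
    rw [← simple_π_pow_val, e]

theorem exchangePerm_pow_succ_inl {a : Fin (m₁ + n₁)} {n : ℕ}
    (h : ∀ k, 0 < k → k ≤ n → rot m₁ n₁ a k ≠ i) (h' : rot m₁ n₁ a (n + 1) = i) :
    (exchangePerm i j ^ (n + 1)) (Sum.inl a) = Sum.inr j := by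
  rw [pow_succ', Equiv.Perm.mul_apply, exchangePerm_pow_inl h, exchangePerm_inl,
    ← Equiv.Perm.mul_apply, ← pow_succ', if_pos]
  rw [Fin.ext_iff, simple_π_pow_val, h']

theorem exchangePerm_pow_succ_inr {b : Fin (m₂ + n₂)} {n : ℕ}
    (h : ∀ k, 0 < k → k ≤ n → rot m₂ n₂ b k ≠ j) (h' : rot m₂ n₂ b (n + 1) = j) :
    (exchangePerm i j ^ (n + 1)) (Sum.inr b) = Sum.inl i := by
  rw [pow_succ', Equiv.Perm.mul_apply, exchangePerm_pow_inr h, exchangePerm_inr,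
    ← Equiv.Perm.mul_apply, ← pow_succ', if_pos]
  rw [Fin.ext_iff, simple_π_pow_val, h']

theorem rot_ne_of_isLeft {a : Fin (m₁ + n₁)} {n : ℕ}
    (h : ∀ k ≤ n, ((exchangePerm i j ^ k) (Sum.inl a)).isLeft) (k : ℕ) (hk : 0 < k) (hkn : k ≤ n) :
    rot m₁ n₁ a k ≠ i := by
  induction k using Nat.strong_induction_on with
  | _ k ih =>
    obtain ⟨l, rfl⟩ := Nat.exists_eq_succ_of_ne_zero hk.ne'
    intro e
    have h1 := h (l + 1) hkn
    rw [exchangePerm_pow_succ_inl (fun q hq hq' => ih q (by omega) hq (by omega)) e] at h1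
    cases h1

theorem forward_inl {a : Fin (m₁ + n₁)} {n : ℕ} (h : ∀ k, 0 < k → k ≤ n → rot m₁ n₁ a k ≠ i) :
    forward (directSum (simple m₁ n₁) (simple m₂ n₂)).δ (exchangePerm i j) (Sum.inl a) n =
      rotLabel m₁ n₁ a n := by
  rw [forward, exchangePerm_pow_inl h, rotLabel, ← simple_π_pow_val]
  exact decide_eq_decide.2 (simple_δ_eq_one_iff _)

theorem forward_inr {b : Fin (m₂ + n₂)} {n : ℕ} (h : ∀ k, 0 < k → k ≤ n → rot m₂ n₂ b k ≠ j) :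
    forward (directSum (simple m₁ n₁) (simple m₂ n₂)).δ (exchangePerm i j) (Sum.inr b) n =
      rotLabel m₂ n₂ b n := by
  rw [forward, exchangePerm_pow_inr h, rotLabel, ← simple_π_pow_val]
  exact decide_eq_decide.2 (simple_δ_eq_one_iff _)

theorem exchangePerm_pow_left (hc : Nat.Coprime m₁ n₁) :
    (exchangePerm i j ^ (m₁ + n₁)) (Sum.inl i) = Sum.inr j := by
  have hi := i.2
  have e : m₁ + n₁ - 1 + 1 = m₁ + n₁ := by omega
  have h := exchangePerm_pow_succ_inl (i := i) (j := j) (n := m₁ + n₁ - 1)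
    (fun k hk hk' => rot_ne hc hi hk (by omega)) (by rw [e, rot_period hi])
  rwa [congrArg (exchangePerm i j ^ ·) e] at h

theorem exchangePerm_pow_right (hc : Nat.Coprime m₂ n₂) :
    (exchangePerm i j ^ (m₂ + n₂)) (Sum.inr j) = Sum.inl i := by
  have hj := j.2
  have e : m₂ + n₂ - 1 + 1 = m₂ + n₂ := by omega
  have h := exchangePerm_pow_succ_inr (i := i) (j := j) (n := m₂ + n₂ - 1)
    (fun k hk hk' => rot_ne hc hj hk (by omega)) (by rw [e, rot_period hj])
  rwa [congrArg (exchangePerm i j ^ ·) e] at h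

theorem forward_add {T : Type*} (δ : T → Fin 2) (π : Equiv.Perm T) (x : T) (k l : ℕ) :
    forward δ π x (k + l) = forward δ π ((π ^ k) x) l := by
  rw [forward, forward, add_comm, pow_add, Equiv.Perm.mul_apply]

theorem isSplit_directSum (hc₁ : Nat.Coprime m₁ n₁) (hc₂ : Nat.Coprime m₂ n₂)
    (hi : m₁ ≤ i.val) (hj : j.val < m₂)
    (hij : (directSum (simple m₁ n₁) (simple m₂ n₂)).ord.lt (Sum.inl i) (Sum.inr j)) :
    IsSplit (directSum (simple m₁ n₁) (simple m₂ n₂)) (Sum.inl i) (Sum.inr j) (m₁ + n₁) where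
  compat := isCompatible_directSum _ _ isCompatible_simple isCompatible_simple
  lt := hij
  label_left := (simple_δ_eq_zero_iff i).2 hi
  label_right := (simple_δ_eq_one_iff j).2 hj
  right := by simp
  zeros := by
    rintro (x | x) hx h1 h2
    · rfl
    · have h3 := (directSum_inr_lt_iff _ _ isCompatible_simple x j).1 h2
      rw [simple_lt_iff] at h3
      have h4 := (simple_δ_eq_zero_iff x).1 hx
      omega
  ones := by
    rintro (x | x) hx h1
    · rw [directSum_inl_lt_iff _ _ isCompatible_simple, simple_lt_iff]
      have h4 := (simple_δ_eq_one_iff x).1 h1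
      omega
    · cases hx
  map_left := by
    rintro (x | x) hx
    · have := exchangePerm_inl (i := i) (j := j) x
      split_ifs at this with h
      · exact Or.inr this
      · exact Or.inl (by rw [this]; rfl)
    · cases hx
  -- A rotation with coprime parameters fixes a point only if its summand has one element, and that
  -- element is sent to the other summand.
  map_ne := by
    rintro (x | x) hx
    · have h1 := exchangePerm_inl (i := i) (j := j) x
      rw [hx] at h1
      split_ifs at h1 with h
      have h2 : rot m₁ n₁ x 1 = x := by
        rw [← simple_π_pow_val, pow_one, ← Sum.inl.inj h1]
      have h3 : m₁ + n₁ = 1 := by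
        by_contra hne
        have := x.2
        exact rot_ne hc₁ x.2 one_pos (by omega) h2
      apply h
      have := i.2
      have := ((simple m₁ n₁).π x).2
      exact Fin.ext (by omega)
    · have h1 := exchangePerm_inr (i := i) (j := j) x
      rw [hx] at h1
      split_ifs at h1 with h
      have h2 : rot m₂ n₂ x 1 = x := by
        rw [← simple_π_pow_val, pow_one, ← Sum.inr.inj h1]
      have h3 : m₂ + n₂ = 1 := by
        by_contra hne
        have := x.2
        exact rot_ne hc₂ x.2 one_pos (by omega) h2
      apply h
      have := j.2
      have := ((simple m₂ n₂).π x).2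
      exact Fin.ext (by omega)
  orbit := by
    intro n hn
    rw [exchangePerm_pow_inl fun k hk hk' => rot_ne hc₁ i.2 hk (by omega)]
    rfl
  -- Cancelling `πⁿ` leaves `u = π s`. This is `t`, or the element `i - m₁` of the first summand;
  -- neither lies strictly between `s` and `t`.
  notMem_leftSet := by
    rintro n ⟨u, hu, h1, h2, h3, h4⟩
    rw [pow_succ, Equiv.Perm.mul_apply] at h4
    have h5 := (smallMod (directSum (simple m₁ n₁) (simple m₂ n₂)).π (Sum.inl i)
      (Sum.inr j) ^ n).injective h4
    rw [exchangePerm_inl] at h5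
    split_ifs at h5 with h6
    · rw [h5] at h2
      exact ne_of_lt' _ h2 rfl
    · rw [h5, directSum_inl_lt_iff _ _ isCompatible_simple, simple_lt_iff, simple_π_val,
        if_neg (by omega)] at h1
      omega
  notMem_rightSet := by
    rintro n ⟨w, hw, h1, h2, h3, h4⟩
    rw [pow_succ, Equiv.Perm.mul_apply] at h4
    have h5 := (smallMod (directSum (simple m₁ n₁) (simple m₂ n₂)).π (Sum.inl i)
      (Sum.inr j) ^ n).injective h4
    rw [exchangePerm_inr] at h5
    split_ifs at h5 with h6
    · rw [h5] at h1
      exact ne_of_lt' _ h1 rfl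
    · rw [h5, directSum_inr_lt_iff _ _ isCompatible_simple, simple_lt_iff, simple_π_val,
        if_pos hj] at h2
      omega

end Orbits

theorem seqLt_tail {f g : ℕ → Bool} {p : ℕ} (h : SeqLt f g) (hp : ∀ k < p, f k = g k) :
    SeqLt (fun k => f (p + k)) (fun k => g (p + k)) := by
  obtain ⟨n, h1, h2, h3⟩ := h
  have hpn : p ≤ n := by
    by_contra hlt
    have := hp n (by omega)
    rw [h2, h3] at this
    cases this
  refine ⟨n - p, fun k hk => h1 _ (by omega), ?_, ?_⟩
  · dsimp only; rwa [Nat.add_sub_cancel' hpn]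
  · dsimp only; rwa [Nat.add_sub_cancel' hpn]

/-! ### Hits and the comparison of label sequences -/

section Hits

variable {m₁ n₁ m₂ n₂ : ℕ} {i : Fin (m₁ + n₁)} {j : Fin (m₂ + n₂)}

/-- Two different points of the first summand show different labels within one period, so none
follows `s` that long; this makes the first process stop. -/
theorem leftSet_eq_empty (hc₁ : Nat.Coprime m₁ n₁) (hc₂ : Nat.Coprime m₂ n₂)
    (hi : m₁ ≤ i.val) (hj : j.val < m₂)
    (hij : (directSum (simple m₁ n₁) (simple m₂ n₂)).ord.lt (Sum.inl i) (Sum.inr j)) :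
    leftSet (directSum (simple m₁ n₁) (simple m₂ n₂)) (Sum.inl i) (Sum.inr j) (m₁ + n₁ - 1) =
      ∅ := by
  rw [Set.eq_empty_iff_forall_notMem]
  rintro x ⟨u, hu, h1, h2, h3, -⟩
  have hsplit := isSplit_directSum hc₁ hc₂ hi hj hij
  obtain ⟨a, rfl⟩ := Sum.isLeft_iff.1 (hsplit.zeros u hu h1 h2)
  rw [directSum_inl_lt_iff _ _ isCompatible_simple, simple_lt_iff] at h1
  obtain ⟨k, hk, -, h4, h5⟩ := exists_first_rotLabel_ne hc₁ a.2 h1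
  have h6 := forward_eq_iff.2 (h3 k (by omega)).2
  rw [forward_inl fun l hl hl' => rot_ne_of_isLeft (fun q hq => (h3 q hq).1) l hl (by omega),
    forward_inl fun l hl hl' => rot_ne hc₁ i.2 hl (by omega), h4, h5] at h6
  cases h6

/-- If the preimage of `j` is met, the label sequences do not compare as they should. -/
theorem not_seqLt_of_mem_leftSet (hc₁ : Nat.Coprime m₁ n₁) (hc₂ : Nat.Coprime m₂ n₂)
    (h₁ : m₁ < n₁) (h₂ : n₂ < m₂)
    (hi : m₁ ≤ i.val) (hj : j.val < m₂)
    (hij : (directSum (simple m₁ n₁) (simple m₂ n₂)).ord.lt (Sum.inl i) (Sum.inr j)) {n : ℕ}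
    (hn : n + 1 < m₁ + n₁)
    (hmem : (exchangePerm i j).symm (Sum.inr j) ∈ leftSet
        (directSum (simple m₁ n₁) (simple m₂ n₂)) (Sum.inl i) (Sum.inr j) n) :
    ∃ u, (directSum (simple m₁ n₁) (simple m₂ n₂)).δ u = 0 ∧
        (directSum (simple m₁ n₁) (simple m₂ n₂)).ord.lt (Sum.inl i) u ∧
            (directSum (simple m₁ n₁) (simple m₂ n₂)).ord.lt u (Sum.inr j) ∧
      ¬ SeqLt (forward (directSum (simple m₁ n₁) (simple m₂ n₂)).δ (exchangePerm i j) u)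
        (forward (directSum (simple m₁ n₁) (simple m₂ n₂)).δ (exchangePerm i j) (Sum.inl i)) := by
  obtain ⟨u, hu, hu1, hu2, h3, h4⟩ := hmem
  refine ⟨u, hu, hu1, hu2, fun hlt => ?_⟩
  have hsplit := isSplit_directSum hc₁ hc₂ hi hj hij
  obtain ⟨a, rfl⟩ := Sum.isLeft_iff.1 (hsplit.zeros u hu hu1 hu2)
  have hne := rot_ne_of_isLeft fun q hq => (h3 q hq).1
  have hend : (exchangePerm i j ^ (n + 1)) (Sum.inl a) = Sum.inr j := by
    rw [pow_succ', Equiv.Perm.mul_apply, h4, Equiv.apply_symm_apply]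
  have hrot : rot m₁ n₁ a (n + 1) = i := by
    by_contra hne'
    have := exchangePerm_pow_inl (i := i) (j := j) (a := a) (n := n + 1) fun k hk hk' => by
      rcases Nat.le_succ_iff.1 hk' with h | rfl
      · exact hne k hk h
      · exact hne'
    rw [hend] at this
    cases this
  -- The rotation takes `a` to `i` in `n + 1` steps, so the labels of `a` up to the hit are the last
  -- `n + 1` letters of the word of `i`; agreement with `s` makes them a border.
  have ha : (a : ℕ) = rot m₁ n₁ i (m₁ + n₁ - (n + 1)) := by
    rw [← hrot, rot_rot, show n + 1 + (m₁ + n₁ - (n + 1)) = m₁ + n₁ by omega, rot_period a.2]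
  have hagree : ∀ k < n + 1, forward (directSum (simple m₁ n₁) (simple m₂ n₂)).δ
      (exchangePerm i j) (Sum.inl a) k =
      forward (directSum (simple m₁ n₁) (simple m₂ n₂)).δ (exchangePerm i j) (Sum.inl i) k := fun
          k hk =>
    forward_eq_iff.2 (h3 k (by omega)).2
  have hshift := seqLt_tail hlt hagree
  -- After the hit the orbit continues from `t`, which the orbit of `s` reaches after `m₁ + n₁`
  -- steps.
  have e1 : (fun k => forward (directSum (simple m₁ n₁) (simple m₂ n₂)).δ (exchangePerm i j)
      (Sum.inl a) (n + 1 + k)) =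
      fun k => forward (directSum (simple m₁ n₁) (simple m₂ n₂)).δ (exchangePerm i j) (Sum.inl i)
          (m₁ + n₁ + k) := by
    funext k
    rw [forward_add, forward_add, hend, exchangePerm_pow_left hc₁]
  rw [e1] at hshift
  refine not_seqLt_of_rot (i := i) (j := j) hc₂ h₁ h₂ i.2 hi hj
    (forward (directSum (simple m₁ n₁) (simple m₂ n₂)).δ (exchangePerm i j) (Sum.inl i))
        (fun k => ?_) (fun k hk => ?_) (fun k hk => ?_)
    (Nat.succ_pos n) hn (fun k hk => ?_) hshift
  · rw [add_comm k, add_assoc, forward_add, forward_add, exchangePerm_pow_left hc₁,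
      exchangePerm_pow_right hc₂]
  · exact forward_inl fun l hl hl' => rot_ne hc₁ i.2 hl (by omega)
  · rw [forward_add, exchangePerm_pow_left hc₁]
    exact forward_inr fun l hl hl' => rot_ne hc₂ j.2 hl (by omega)
  · rw [← hagree k hk, forward_inl fun l hl hl' => hne l hl (by omega), add_comm k, ← rotLabel_rot,
      ← ha]

/-- If the preimage of `i` is met, the label sequences do not compare as they should. -/
theorem not_seqLt_of_mem_rightSet (hc₁ : Nat.Coprime m₁ n₁) (hc₂ : Nat.Coprime m₂ n₂)
    (h₁ : m₁ < n₁) (h₂ : n₂ < m₂)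
    (hi : m₁ ≤ i.val) (hj : j.val < m₂)
    (hij : (directSum (simple m₁ n₁) (simple m₂ n₂)).ord.lt (Sum.inl i) (Sum.inr j)) {n : ℕ}
    (hmem : (exchangePerm i j).symm (Sum.inl i) ∈ rightSet
        (directSum (simple m₁ n₁) (simple m₂ n₂)) (Sum.inl i) (Sum.inr j) n) :
    ∃ w, (directSum (simple m₁ n₁) (simple m₂ n₂)).δ w = 1 ∧
        (directSum (simple m₁ n₁) (simple m₂ n₂)).ord.lt (Sum.inl i) w ∧
            (directSum (simple m₁ n₁) (simple m₂ n₂)).ord.lt w (Sum.inr j) ∧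
      ¬ SeqLt (forward (directSum (simple m₁ n₁) (simple m₂ n₂)).δ (exchangePerm i j) (Sum.inr j))
        (forward (directSum (simple m₁ n₁) (simple m₂ n₂)).δ (exchangePerm i j) w) := by
  obtain ⟨w, hw, hw1, hw2, h3, h4⟩ := hmem
  refine ⟨w, hw, hw1, hw2, fun hlt => ?_⟩
  have hsplit := isSplit_directSum hc₁ hc₂ hi hj hij
  obtain ⟨b, rfl⟩ : ∃ b, w = Sum.inr b := by
    rcases w with a | b
    · exact absurd (hsplit.ones _ rfl hw) (not_lt_of_lt _ hw1)
    · exact ⟨b, rfl⟩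
  rw [directSum_inr_lt_iff _ _ isCompatible_simple, simple_lt_iff] at hw2
  have hend : (exchangePerm i j ^ (n + 1)) (Sum.inr b) = Sum.inl i := by
    rw [pow_succ', Equiv.Perm.mul_apply, h4, Equiv.apply_symm_apply]
  have hex : ∃ q, rot m₂ n₂ b (q + 1) = j := by
    obtain ⟨k, hk, hk'⟩ := exists_rot_eq (a := b) hc₂ j.2
    cases k with
    | zero => rw [rot_zero b.2] at hk'; omega
    | succ k => exact ⟨k, hk'⟩
  classical
  -- `rightSet` does not confine the orbit to the second summand, so `n` need not be the first
  -- passage; the border is read off at the first one.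
  obtain ⟨q, hq, hqmin⟩ : ∃ q, rot m₂ n₂ b (q + 1) = j ∧
      ∀ k, 0 < k → k ≤ q → rot m₂ n₂ b k ≠ j := by
    refine ⟨Nat.find hex, Nat.find_spec hex, fun k hk hk' h => ?_⟩
    obtain ⟨l, rfl⟩ := Nat.exists_eq_succ_of_ne_zero hk.ne'
    exact Nat.find_min hex (m := l) (by omega) h
  have hqh : q + 1 < m₂ + n₂ := by
    obtain ⟨k, hk, hk'⟩ := exists_rot_eq (a := b) hc₂ j.2
    by_contra hlt
    refine hqmin k (Nat.pos_of_ne_zero ?_) (by omega) hk'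
    rintro rfl
    rw [rot_zero b.2] at hk'; omega
  have hqn : q ≤ n := by
    by_contra hlt
    rw [exchangePerm_pow_inr fun k hk hk' => hqmin k hk (by omega)] at hend
    cases hend
  have hend' := exchangePerm_pow_succ_inr (i := i) hqmin hq
  have hb : (b : ℕ) = rot m₂ n₂ j (m₂ + n₂ - (q + 1)) := by
    rw [← hq, rot_rot, show q + 1 + (m₂ + n₂ - (q + 1)) = m₂ + n₂ by omega, rot_period b.2]
  have hagree : ∀ k < q + 1, forward (directSum (simple m₁ n₁) (simple m₂ n₂)).δ
      (exchangePerm i j) (Sum.inr j) k =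
      forward (directSum (simple m₁ n₁) (simple m₂ n₂)).δ (exchangePerm i j) (Sum.inr b) k := fun
          k hk =>
    (forward_eq_iff.2 (h3 k (by omega))).symm
  have hshift := seqLt_tail hlt hagree
  have e1 : (fun k => forward (directSum (simple m₁ n₁) (simple m₂ n₂)).δ (exchangePerm i j)
      (Sum.inr b) (q + 1 + k)) =
      fun k => forward (directSum (simple m₁ n₁) (simple m₂ n₂)).δ (exchangePerm i j) (Sum.inr j)
          (m₂ + n₂ + k) := by
    funext k
    rw [forward_add, forward_add, hend', exchangePerm_pow_right hc₂]
  rw [e1] at hshift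
  refine not_seqLt_of_rot' (i := i) (j := j) hc₁ h₁ h₂ i.2 hi hj
    (forward (directSum (simple m₁ n₁) (simple m₂ n₂)).δ (exchangePerm i j) (Sum.inr j))
        (fun k => ?_) (fun k hk => ?_) (fun k hk => ?_)
    (Nat.succ_pos q) hqh (fun k hk => ?_) hshift
  · rw [add_comm k, add_assoc, forward_add, forward_add, exchangePerm_pow_right hc₂,
      exchangePerm_pow_left hc₁]
  · exact forward_inr fun l hl hl' => rot_ne hc₂ j.2 hl (by omega)
  · rw [forward_add, exchangePerm_pow_right hc₂]
    exact forward_inl fun l hl hl' => rot_ne hc₁ i.2 hl (by omega)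
  · rw [hagree k hk, forward_inr fun l hl hl' => hqmin l hl (by omega), add_comm k, ← rotLabel_rot,
      ← hb]

/-- Until the orbit of `a` leaves the first summand its labels are those of the rotation, for which
the larger point shows the 0 at the first difference. Either this happens in time, or the orbit
leaves with all labels equal, which is a hit. -/
theorem seqLt_or_mem_leftSet (hc₁ : Nat.Coprime m₁ n₁) {a : Fin (m₁ + n₁)}
    (ha : (directSum (simple m₁ n₁) (simple m₂ n₂)).δ (Sum.inl a) = 0)
    (h1 : (directSum (simple m₁ n₁) (simple m₂ n₂)).ord.lt (Sum.inl i) (Sum.inl a))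
    (h2 : (directSum (simple m₁ n₁) (simple m₂ n₂)).ord.lt (Sum.inl a) (Sum.inr j)) :
    SeqLt (forward (directSum (simple m₁ n₁) (simple m₂ n₂)).δ (exchangePerm i j) (Sum.inl a))
        (forward (directSum (simple m₁ n₁) (simple m₂ n₂)).δ (exchangePerm i j) (Sum.inl i)) ∨
      ∃ n < m₁ + n₁, (exchangePerm i j).symm (Sum.inr j) ∈
        leftSet (directSum (simple m₁ n₁) (simple m₂ n₂)) (Sum.inl i) (Sum.inr j) n := by
  have h1' := h1
  rw [directSum_inl_lt_iff _ _ isCompatible_simple, simple_lt_iff] at h1'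
  obtain ⟨r, hr, hl, hr0, hr1⟩ := exists_first_rotLabel_ne hc₁ a.2 h1'
  have hs : ∀ k < m₁ + n₁, forward (directSum (simple m₁ n₁) (simple m₂ n₂)).δ (exchangePerm i j)
      (Sum.inl i) k = rotLabel m₁ n₁ i k :=
    fun k hk => forward_inl fun l hl hl' => rot_ne hc₁ i.2 hl (by omega)
  by_cases hex : ∃ q < r, rot m₁ n₁ a (q + 1) = i
  · classical
    right
    have hq := Nat.find_spec hex
    have hmin : ∀ k, 0 < k → k ≤ Nat.find hex → rot m₁ n₁ a k ≠ i := by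
      intro k hk hk' h
      obtain ⟨l, rfl⟩ := Nat.exists_eq_succ_of_ne_zero hk.ne'
      exact Nat.find_min hex (m := l) (by omega) ⟨by omega, h⟩
    refine ⟨Nat.find hex, by omega, Sum.inl a, ha, h1, h2, fun k hk => ⟨?_, ?_⟩, ?_⟩
    · rw [exchangePerm_pow_inl fun l hl hl' => hmin l hl (by omega)]
      rfl
    · refine forward_eq_iff.1 ?_
      rw [hs k (by omega), forward_inl fun l hl hl' => hmin l hl (by omega)]
      exact hl k (by omega)
    · have h := exchangePerm_pow_succ_inl (i := i) (j := j) hmin hq.2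
      rw [pow_succ', Equiv.Perm.mul_apply] at h
      exact (Equiv.eq_symm_apply _).2 h
  · left
    have hu : ∀ k ≤ r, forward (directSum (simple m₁ n₁) (simple m₂ n₂)).δ (exchangePerm i j)
        (Sum.inl a) k = rotLabel m₁ n₁ a k := by
      refine fun k hk => forward_inl fun l hl hl' h => ?_
      obtain ⟨q, rfl⟩ := Nat.exists_eq_succ_of_ne_zero hl.ne'
      exact hex ⟨q, by omega, h⟩
    refine ⟨r, fun k hk => ?_, ?_, ?_⟩
    · rw [hu k (by omega), hs k (by omega), hl k hk]
    · rw [hu r le_rfl, hr0]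
    · rw [hs r hr, hr1]

theorem seqLt_or_mem_rightSet (hc₂ : Nat.Coprime m₂ n₂) {b : Fin (m₂ + n₂)}
    (hb : (directSum (simple m₁ n₁) (simple m₂ n₂)).δ (Sum.inr b) = 1)
    (h1 : (directSum (simple m₁ n₁) (simple m₂ n₂)).ord.lt (Sum.inl i) (Sum.inr b))
    (h2 : (directSum (simple m₁ n₁) (simple m₂ n₂)).ord.lt (Sum.inr b) (Sum.inr j)) :
    SeqLt (forward (directSum (simple m₁ n₁) (simple m₂ n₂)).δ (exchangePerm i j) (Sum.inr j))
        (forward (directSum (simple m₁ n₁) (simple m₂ n₂)).δ (exchangePerm i j) (Sum.inr b)) ∨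
      ∃ n, (exchangePerm i j).symm (Sum.inl i) ∈ rightSet
          (directSum (simple m₁ n₁) (simple m₂ n₂)) (Sum.inl i) (Sum.inr j) n := by
  have h2' := h2
  rw [directSum_inr_lt_iff _ _ isCompatible_simple, simple_lt_iff] at h2'
  obtain ⟨r, hr, hl, hr0, hr1⟩ := exists_first_rotLabel_ne hc₂ j.2 h2'
  have hs : ∀ k < m₂ + n₂, forward (directSum (simple m₁ n₁) (simple m₂ n₂)).δ (exchangePerm i j)
      (Sum.inr j) k = rotLabel m₂ n₂ j k :=
    fun k hk => forward_inr fun l hl hl' => rot_ne hc₂ j.2 hl (by omega)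
  by_cases hex : ∃ q < r, rot m₂ n₂ b (q + 1) = j
  · classical
    right
    have hq := Nat.find_spec hex
    have hmin : ∀ k, 0 < k → k ≤ Nat.find hex → rot m₂ n₂ b k ≠ j := by
      intro k hk hk' h
      obtain ⟨l, rfl⟩ := Nat.exists_eq_succ_of_ne_zero hk.ne'
      exact Nat.find_min hex (m := l) (by omega) ⟨by omega, h⟩
    refine ⟨Nat.find hex, Sum.inr b, hb, h1, h2, fun k hk => ?_, ?_⟩
    · refine forward_eq_iff.1 ?_
      rw [hs k (by omega), forward_inr fun l hl hl' => hmin l hl (by omega)]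
      exact (hl k (by omega)).symm
    · have h := exchangePerm_pow_succ_inr (i := i) (j := j) hmin hq.2
      rw [pow_succ', Equiv.Perm.mul_apply] at h
      exact (Equiv.eq_symm_apply _).2 h
  · left
    have hu : ∀ k ≤ r, forward (directSum (simple m₁ n₁) (simple m₂ n₂)).δ (exchangePerm i j)
        (Sum.inr b) k = rotLabel m₂ n₂ b k := by
      refine fun k hk => forward_inr fun l hl hl' h => ?_
      obtain ⟨q, rfl⟩ := Nat.exists_eq_succ_of_ne_zero hl.ne'
      exact hex ⟨q, by omega, h⟩
    refine ⟨r, fun k hk => ?_, ?_, ?_⟩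
    · rw [hu k (by omega), hs k (by omega), hl k hk]
    · rw [hs r hr, hr0]
    · rw [hu r le_rfl, hr1]

end Hits

end ABS
end

/-! ### The theorem -/

theorem theorem4p1 (p : ℕ) [Fact p.Prime] (K : Type*) [Field K] [CharP K p] [PerfectRing K p]
    (m₁ n₁ m₂ n₂ : ℕ) (hcop₁ : Nat.Coprime m₁ n₁) (hcop₂ : Nat.Coprime m₂ n₂)
    (hslope₂ : (n₂ : ℚ) / (m₂ + n₂) < 1 / 2) (hslope₁ : 1 / 2 < (n₁ : ℚ) / (m₁ + n₁))
    (S : ABS (Fin (m₁ + n₁) ⊕ Fin (m₂ + n₂)))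
    (hS : S = ABS.directSum (ABS.simple m₁ n₁) (ABS.simple m₂ n₂)) :
    S.IsAssociated (DM1.prod (DM1.simple p K m₁ n₁) (DM1.simple p K m₂ n₂)) ∧
    ∀ (i : Fin (m₁ + n₁)) (j : Fin (m₂ + n₂)),
      S.δ (Sum.inl i) = 0 → S.δ (Sum.inr j) = 1 → S.ord.lt (Sum.inl i) (Sum.inr j) →
      (∃ n, ABS.aSet S (Sum.inl i) (Sum.inr j) n = ∅) ∧
      ∀ S' : ABS (Fin (m₁ + n₁) ⊕ Fin (m₂ + n₂)),
        ABS.IsExchange S (Sum.inl i) (Sum.inr j) S' →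
        ((S'.length : ℤ) = (S.length : ℤ) - 1 ↔
          ¬ ∃ n, S'.π.symm (Sum.inr j) ∈ ABS.aSet S (Sum.inl i) (Sum.inr j) n ∨
            S'.π.symm (Sum.inl i) ∈ ABS.bSet S (Sum.inl i) (Sum.inr j) n) := by
  subst hS
  refine ⟨ABS.isAssociated_directSum p K m₁ n₁ m₂ n₂, fun i j hi hj hij => ?_⟩
  have h₁ : m₁ < n₁ := by
    have hpos : (0 : ℚ) < m₁ + n₁ := by
      have := i.2
      exact_mod_cast (by omega : 0 < m₁ + n₁)
    rw [div_lt_div_iff₀ two_pos hpos] at hslope₁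
    have : m₁ + n₁ < n₁ * 2 := by exact_mod_cast (by linarith : (m₁ + n₁ : ℚ) < n₁ * 2)
    omega
  have h₂ : n₂ < m₂ := by
    have hpos : (0 : ℚ) < m₂ + n₂ := by
      have := j.2
      exact_mod_cast (by omega : 0 < m₂ + n₂)
    rw [div_lt_div_iff₀ hpos two_pos] at hslope₂
    have : n₂ * 2 < m₂ + n₂ := by exact_mod_cast (by linarith : (n₂ * 2 : ℚ) < m₂ + n₂)
    omega
  have hi' : m₁ ≤ i.val := (ABS.simple_δ_eq_zero_iff i).1 hi
  have hj' : j.val < m₂ := (ABS.simple_δ_eq_one_iff j).1 hj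
  have hsplit := ABS.isSplit_directSum hcop₁ hcop₂ hi' hj' hij
  have hlast : m₁ + n₁ - 1 < m₁ + n₁ := by have := i.2; omega
  have hempty := ABS.aSet_eq_leftSet hsplit _ hlast
  rw [ABS.leftSet_eq_empty hcop₁ hcop₂ hi' hj' hij] at hempty
  refine ⟨⟨_, hempty⟩, fun S' hS' => ?_⟩
  have hlen := ABS.length_exchange_iff _ hsplit.compat hij hi hj S' hS'
  have hcast : ((S'.length : ℤ) =
      ((ABS.directSum (ABS.simple m₁ n₁) (ABS.simple m₂ n₂)).length : ℤ) - 1) ↔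
      S'.length + 1 = (ABS.directSum (ABS.simple m₁ n₁) (ABS.simple m₂ n₂)).length := by omega
  rw [hcast, hlen, hS'.π_eq]
  constructor
  · rintro ⟨hl, hr⟩ hex
    -- `ℬ⁽ⁿ⁾` is known to be `rightSet` only if the first process has no hit. A hit there already
    -- contradicts `hl`, so it is excluded first.
    have hA : ∀ n, (ABS.exchangePerm i j).symm (Sum.inr j) ∉
        ABS.aSet (ABS.directSum (ABS.simple m₁ n₁) (ABS.simple m₂ n₂)) (Sum.inl i)
          (Sum.inr j) n := by
      intro n hn
      by_cases hlt : n + 1 < m₁ + n₁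
      · rw [ABS.aSet_eq_leftSet hsplit n (by omega)] at hn
        obtain ⟨u, hu, h1, h2, h3⟩ :=
          ABS.not_seqLt_of_mem_leftSet hcop₁ hcop₂ h₁ h₂ hi' hj' hij hlt hn
        exact h3 (hl u hu h1 h2)
      · rw [ABS.aSet_eq_empty_of_le hempty (by omega)] at hn
        exact hn
    obtain ⟨n, hn | hn⟩ := hex
    · exact hA n hn
    · rw [ABS.bSet_eq_rightSet hsplit hlast hempty hA n] at hn
      obtain ⟨w, hw, h1, h2, h3⟩ :=
        ABS.not_seqLt_of_mem_rightSet hcop₁ hcop₂ h₁ h₂ hi' hj' hij hn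
      exact h3 (hr w hw h1 h2)
  · intro hno
    have hA : ∀ n, (ABS.exchangePerm i j).symm (Sum.inr j) ∉
        ABS.aSet (ABS.directSum (ABS.simple m₁ n₁) (ABS.simple m₂ n₂)) (Sum.inl i)
          (Sum.inr j) n := fun n hn => hno ⟨n, Or.inl hn⟩
    refine ⟨fun u hu h1 h2 => ?_, fun w hw h1 h2 => ?_⟩
    · obtain ⟨a, rfl⟩ := Sum.isLeft_iff.1 (hsplit.zeros u hu h1 h2)
      refine (ABS.seqLt_or_mem_leftSet hcop₁ hu h1 h2).resolve_right ?_
      rintro ⟨n, hn, hmem⟩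
      rw [← ABS.aSet_eq_leftSet hsplit n hn] at hmem
      exact hA n hmem
    · rcases w with a | b
      · exact absurd (hsplit.ones _ rfl hw) (ABS.not_lt_of_lt _ h1)
      · refine (ABS.seqLt_or_mem_rightSet hcop₂ hw h1 h2).resolve_right ?_
        rintro ⟨n, hmem⟩
        rw [← ABS.bSet_eq_rightSet hsplit hlast hempty hA n] at hmem
        exact hno ⟨n, Or.inr hmem⟩
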